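/- Let $X$ and $Y$ be Polish spaces, $d_Y$ a compatible metric on $Y$ and $t\in[1,\infty)$. Write $\mathcal P(Z)$ for the Borel probability measures on a Polish space $Z$, with the weak topology, and $$\mathcal P^t_{d_Y}(Y)=\Big\{p\in\mathcal P(Y):\int d_Y(y,y_0)^t\,p(dy)<\infty\text{ for some }y_0\in Y\Big\},$$ with the topology of the Wasserstein distance $\mathcal W_t$. Let $C\colon X\times\mathcal P^t_{d_Y}(Y)\to\mathbb R\cup\{+\infty\}$ be lower semicontinuous for the product topology and bounded from below (Condition (A)), and let $\mu\in\mathcal P(X)$ and $\nu\in\mathcal P^t_{d_Y}(Y)$. Let $\Phi_{b,t}$ be the set of continuous $\psi\colon Y\to\mathbb R$ that are bounded from below and satisfy $|\psi(y)|\le a+b\,d_Y(y,y_0)^t$ for all $y\in Y$, for some $a,b\ge 0$ and $y_0\in Y$. For $p\in\mathcal P(Y)$ write $p(\psi)=\int\psi\,dp$, and for $\psi\in\Phi_{b,t}$ put $$R_C\psi(x)=\inf_{p\in\mathcal P^t_{d_Y}(Y)}\big(p(\psi)+C(x,p)\big),\qquad x\in X.$$ Let $\Lambda(\mu,\nu)$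 be the set of $P\in\mathcal P(X\times\mathcal P(Y))$ with $X$-marginal $\mu$ such that $\int p(f)\,P(dx,dp)=\nu(f)$ for all bounded continuous $f\colon Y\to\mathbb R$; every such $P$ is concentrated on $X\times\mathcal P^t_{d_Y}(Y)$. Let $\Pi(\mu,\nu)$ be the set of couplings of $\mu$ and $\nu$, and for $\pi\in\Pi(\mu,\nu)$ let $(\pi_x)_{x\in X}$ be its disintegration with respect to $\mu$; here $\pi_x\in\mathcal P^t_{d_Y}(Y)$ for $\mu$-almost every $x$. **Theorem 3.1.** For every $\psi\in\Phi_{b,t}$ the function $R_C\psi$ is $\mu$-measurable (so that, being bounded from below, it has an integral in $\mathbb R\cup\{+\infty\}$), and $$\inf_{P\in\Lambda(\mu,\nu)}\int_{X\times\mathcal P(Y)}C(x,p)\,P(dx,dp)=\sup_{\psi\in\Phi_{b,t}}\Big(-\nu(\psi)+\int_X R_C\psi(x)\,\mu(dx)\Big).$$ If moreover $C(x,\cdot)$ is convex for every $x\in X$, that is, $C(x,\alpha p+(1-\alpha)q)\le\alpha C(x,p)+(1-\alpha)C(x,q)$ for all $p,q\in\mathcal P^t_{d_Y}(Y)$ and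 $\alpha\in[0,1]$ (Condition (A+)), then $$V(\mu,\nu):=\inf_{\pi\in\Pi(\mu,\nu)}\int_X C(x,\pi_x)\,\mu(dx)=\sup_{\psi\in\Phi_{b,t}}\Big(-\nu(\psi)+\int_X R_C\psi(x)\,\mu(dx)\Big).$$ Both equalities hold in $\mathbb R\cup\{+\infty\}$. -/

import Mathlib

open MeasureTheory Set
open scoped ENNReal BoundedContinuousFunction

noncomputable section

namespace WeakTransport

/-- Integral `∫ f dm = ∫ f⁺ dm - ∫ f⁻ dm` of an extended real function. It is only used for
probability measures `m` and functions `f` that are bounded from below by a real number, so that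
the second term is finite. -/
def eintegral {Z : Type*} [MeasurableSpace Z] (m : Measure Z) (f : Z → EReal) : EReal :=
  ((∫⁻ z, (f z).toENNReal ∂m : ℝ≥0∞) : EReal) - ((∫⁻ z, (-f z).toENNReal ∂m : ℝ≥0∞) : EReal)

/-- `Π(μ, ν)`: the couplings of `μ` and `ν`. -/
def couplings {X Y : Type*} [MeasurableSpace X] [MeasurableSpace Y]
    (μ : ProbabilityMeasure X) (ν : ProbabilityMeasure Y) : Set (ProbabilityMeasure (X × Y)) :=
  {π | (π : Measure (X × Y)).map Prod.fst = (μ : Measure X) ∧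
    (π : Measure (X × Y)).map Prod.snd = (ν : Measure Y)}

section Wasserstein

variable {Y : Type*} [MetricSpace Y] [MeasurableSpace Y]

/-- `∫ d(y, y₀)^t p(dy) < ∞` for some `y₀`. -/
def HasFiniteMoment (t : ℝ) (p : ProbabilityMeasure Y) : Prop :=
  ∃ y₀ : Y, ∫⁻ y, edist y y₀ ^ t ∂(p : Measure Y) < ∞

variable (Y) in
/-- The set `P^t(Y)` of probability measures on `Y` with finite `t`-th moment, as a type of its
own: it carries the topology of `W_t` and not the subspace topology of weak convergence. -/
structure WassersteinSpace (t : ℝ) where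
  toProb : ProbabilityMeasure Y
  finite_moment : HasFiniteMoment t toProb

/-- The `t`-Wasserstein distance. -/
def wassersteinDist (t : ℝ) (p q : ProbabilityMeasure Y) : ℝ≥0∞ :=
  (⨅ π ∈ couplings p q, ∫⁻ z, edist z.1 z.2 ^ t ∂(π : Measure (Y × Y))) ^ (1 / t)

/-- The topology generated by `W_t`, that is, by its open balls. -/
instance (t : ℝ) : TopologicalSpace (WassersteinSpace Y t) :=
  TopologicalSpace.generateFrom
    {s | ∃ (p : WassersteinSpace Y t) (r : ℝ≥0∞),
      s = {q | wassersteinDist t p.toProb q.toProb < r}}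

variable (Y) in
/-- `Φ_{b,t}`: the continuous functions on `Y` with growth of order at most `t` that are bounded
from below. -/
def PhiB (t : ℝ) : Set (Y → ℝ) :=
  {ψ | Continuous ψ ∧ (∃ (y₀ : Y) (a b : ℝ), 0 ≤ a ∧ 0 ≤ b ∧ ∀ y, |ψ y| ≤ a + b * dist y y₀ ^ t) ∧
    ∃ l : ℝ, ∀ y, l ≤ ψ y}

end Wasserstein

section Cost

variable {X Y : Type*} [MetricSpace Y] [MeasurableSpace Y]

/-- Condition (A): `C` is lower semicontinuous for the product of the topology of `X` and the
`W_t`-topology, and bounded from below by a real number (so it does not take the value `-∞`). -/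
structure ConditionA [TopologicalSpace X] {t : ℝ} (C : X × WassersteinSpace Y t → EReal) :
    Prop where
  lsc : LowerSemicontinuous C
  bddBelow : ∃ c : ℝ, ∀ z, (c : EReal) ≤ C z

/-- Condition (A+): (A), and every `C(x, ·)` is convex. Here `r` is the mixture
`α p + (1 - α) q`, which again lies in `P^t(Y)`. -/
structure ConditionAPlus [TopologicalSpace X] {t : ℝ} (C : X × WassersteinSpace Y t → EReal) :
    Prop extends ConditionA C where
  convex : ∀ (x : X) (p q r : WassersteinSpace Y t) (α : ℝ), 0 ≤ α → α ≤ 1 →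
    (r.toProb : Measure Y) =
      ENNReal.ofReal α • (p.toProb : Measure Y) + ENNReal.ofReal (1 - α) • (q.toProb : Measure Y) →
    C (x, r) ≤ (α : EReal) * C (x, p) + ((1 - α : ℝ) : EReal) * C (x, q)

open scoped Classical in
/-- `C` as a function on `X × P(Y)`. The value `+∞` off `X × P^t(Y)` plays no role: since
`ν ∈ P^t(Y)`, every `P ∈ Λ(μ, ν)` is concentrated on `X × P^t(Y)`, and for `π ∈ Π(μ, ν)` one has
`π_x ∈ P^t(Y)` for `μ`-almost every `x`. -/
def extendCost {t : ℝ} (C : X × WassersteinSpace Y t → EReal) (z : X × ProbabilityMeasure Y) :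
    EReal :=
  if h : HasFiniteMoment t z.2 then C (z.1, ⟨z.2, h⟩) else ⊤

/-- `R_C ψ (x) = inf { p(ψ) + C(x, p) : p ∈ P^t(Y) }`. -/
def conjugate {t : ℝ} (C : X × WassersteinSpace Y t → EReal) (ψ : Y → ℝ) (x : X) : EReal :=
  ⨅ p : WassersteinSpace Y t, ((∫ y, ψ y ∂(p.toProb : Measure Y) : ℝ) : EReal) + C (x, p)

variable [MeasurableSpace X]

/-- `Λ(μ, ν)`: the probability measures `P` on `X × P(Y)` with `X`-marginal `μ` whose
`P(Y)`-marginal has intensity `ν`, that is, `∫ p(f) P(dx, dp) = ν(f)` for all `f ∈ C_b(Y)`. The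
σ-algebra on `P(Y)` is generated by the evaluations `p ↦ p(B)`; for Polish `Y` it is the Borel
σ-algebra of weak convergence. -/
def liftedCouplings (μ : ProbabilityMeasure X) (ν : ProbabilityMeasure Y) :
    Set (ProbabilityMeasure (X × ProbabilityMeasure Y)) :=
  {P | (P : Measure (X × ProbabilityMeasure Y)).map Prod.fst = (μ : Measure X) ∧
    ∀ f : Y →ᵇ ℝ,
      ∫ p, (∫ y, f y ∂(p : Measure Y))
        ∂((P : Measure (X × ProbabilityMeasure Y)).map Prod.snd) = ∫ y, f y ∂(ν : Measure Y)}

/-- The lifted problem: `inf { ∫ C dP : P ∈ Λ(μ, ν) }`. -/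
def liftedValue {t : ℝ} (C : X × WassersteinSpace Y t → EReal) (μ : ProbabilityMeasure X)
    (ν : ProbabilityMeasure Y) : EReal :=
  ⨅ P ∈ liftedCouplings μ ν, eintegral (P : Measure (X × ProbabilityMeasure Y)) (extendCost C)

/-- The weak transport problem `V(μ, ν) = inf { ∫ C(x, π_x) μ(dx) : π ∈ Π(μ, ν) }`, where
`(π_x)` is the disintegration of `π` with respect to its first marginal. -/
def weakValue [Nonempty Y] [StandardBorelSpace Y] {t : ℝ} (C : X × WassersteinSpace Y t → EReal)
    (μ : ProbabilityMeasure X) (ν : ProbabilityMeasure Y) : EReal :=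
  ⨅ π ∈ couplings μ ν, eintegral (μ : Measure X)
    (fun x ↦ extendCost C (x, ⟨(π : Measure (X × Y)).condKernel x, inferInstance⟩))

/-- `sup { -ν(ψ) + ∫ R_C ψ dμ : ψ ∈ Φ_{b,t} }`. -/
def dualValue {t : ℝ} (C : X × WassersteinSpace Y t → EReal) (μ : ProbabilityMeasure X)
    (ν : ProbabilityMeasure Y) : EReal :=
  ⨆ ψ ∈ PhiB Y t, -((∫ y, ψ y ∂(ν : Measure Y) : ℝ) : EReal) +
    eintegral (μ : Measure X) (conjugate C ψ)

end Cost

end WeakTransport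

end

/-! ### Universal measurability of analytic sets. -/

section

open Filter Topology TopologicalSpace

/-! Weak duality is integration: `R_C ψ(x) ≤ p(ψ) + C(x, p)` for all `x` and `p`, and under `P ∈
Λ(μ, ν)` the mean of `p(ψ)` is `ν(ψ)` (`dual_le_lifted`).

Strong duality is Hahn–Banach and Riesz on a compact space. Embed `X` and `Y` in compact metrizable
spaces `H` and `K`, and send `p` to its image law on `K` together with its `t`-th moment, a point of
`P(K) × [0, ∞]`. The `W_t`-topology is coarser than the topology induced by this map
(`exists_isOpen_wassersteinDist_lt`), so the shifted lower semicontinuous cost is, along the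
embedding, an increasing limit of continuous functions. On the compact product, either some
probability measure satisfies all constraints (cost at most `r`, mean moment at most that of `ν`,
marginal `μ`, intensity `ν`), or a finite combination of the constraints is contradictory
(`exists_relaxed_or_certificate`). In the second case the combination pulls back to a potential `g +
b d(·, y₀)^t`. The moment constraint is one-sided, so `b ≥ 0`; this is why potentials bounded from
below suffice.

In the first case nothing is lost at the boundary. On the closure of the image the moment coordinate
dominates the true moment, while the constraint gives the reverse inequality on average. The two
agree almost everywhere, and the measure comes from `X × P^t(Y)` (`ae_mem_range_pairEmbed`).

For convex costs, the kernel of a lifted coupling is replaced by its barycentres. The cost does not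
increase, by a Jensen inequality (`shiftCost_le_lintegral`) resting on affine minorants with
potentials in `Φ_{b,t}` (`exists_affine_minorant`). Conversely a coupling `π` induces the lifted
coupling that is the law of `(x, π_x)`.

The set `{R_C ψ < r}` is the projection of a Borel set, hence analytic, hence measurable for the
completion of `μ`. -/

/-- Choquet's capacitability argument. Bounding the coordinates of `ℕ → ℕ` one after another keeps
the outer measure of the image above `r`, and the sequences satisfying all the bounds form a compact
set. -/
theorem MeasureTheory.AnalyticSet.exists_isCompact_measure_ge {α : Type*} [TopologicalSpace α]
    [T2Space α] [MeasurableSpace α] [OpensMeasurableSpace α] {s : Set α} (hs : AnalyticSet s)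
    (μ : Measure α) [IsFiniteMeasure μ] {r : ℝ≥0∞} (hr : r < μ s) :
    ∃ K ⊆ s, IsCompact K ∧ r ≤ μ K := by
  rw [AnalyticSet] at hs
  rcases hs with rfl | ⟨f, hf, rfl⟩
  · simp at hr
  -- Continuity from below holds for increasing sequences of arbitrary sets, so the images need not
  -- be measurable.
  have step : ∀ (k : ℕ) (A : Set (ℕ → ℕ)), r < μ (f '' A) →
      ∃ m, r < μ (f '' (A ∩ {x | x k ≤ m})) := by
    intro k A hA
    have hU : f '' A = ⋃ m, f '' (A ∩ {x | x k ≤ m}) := by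
      rw [← image_iUnion, ← inter_iUnion, iUnion_eq_univ_iff.2 fun x => ⟨x k, by simp⟩, inter_univ]
    have hmono : Monotone fun m => f '' (A ∩ {x | x k ≤ m}) := fun a b hab =>
      image_mono (inter_subset_inter_right _ fun x hx => le_trans hx hab)
    rw [hU, hmono.measure_iUnion] at hA
    exact lt_iSup_iff.1 hA
  choose! m hm using step
  let A : ℕ → Set (ℕ → ℕ) := fun k => Nat.rec univ (fun k B => B ∩ {x | x k ≤ m k B}) k
  have hAs : ∀ k, A (k + 1) = A k ∩ {x | x k ≤ m k (A k)} := fun k => rfl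
  have hA : ∀ k, r < μ (f '' A k) := by
    intro k
    induction k with
    | zero => simpa [A] using hr
    | succ k ih => exact hm k _ ih
  set n : ℕ → ℕ := fun k => m k (A k) with hn
  have hA' : ∀ k x, x ∈ A k ↔ ∀ i < k, x i ≤ n i := by
    intro k
    induction k with
    | zero => intro x; simp [A]
    | succ k ih =>
      intro x
      rw [hAs, mem_inter_iff, ih]
      constructor
      · rintro ⟨h1, h2⟩ i hi
        rcases Nat.lt_succ_iff_lt_or_eq.1 hi with h | rfl
        · exact h1 i h
        · exact h2
      · intro h
        exact ⟨fun i hi => h i (hi.trans k.lt_succ_self), h k k.lt_succ_self⟩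
  let S : Set (ℕ → ℕ) := univ.pi fun k => Iic (n k)
  have hS : IsCompact S := isCompact_univ_pi fun k => (finite_Iic _).isCompact
  refine ⟨f '' S, image_subset_range _ _, hS.image hf, ?_⟩
  have hanti : Antitone fun k => closure (f '' A k) := by
    refine antitone_nat_of_succ_le fun k => closure_mono (image_mono ?_)
    rw [hAs]
    exact inter_subset_left
  have hsub : ⋂ k, closure (f '' A k) ⊆ f '' S := by
    intro y hy
    by_contra hyS
    obtain ⟨U, V, hU, hV, hSU, hyV, hUV⟩ :=
      SeparatedNhds.of_isCompact_isCompact (hS.image hf) (isCompact_singleton (x := y))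
        (disjoint_singleton_right.2 hyS)
    have hnot : ∀ k, ∃ x ∈ A k, f x ∉ U := by
      intro k
      by_contra h
      push Not at h
      have h1 : f '' A k ⊆ U := image_subset_iff.2 h
      have h2 := mem_closure_iff.1 (mem_iInter.1 hy k) V hV (hyV rfl)
      obtain ⟨z, hzV, hz⟩ := h2
      exact disjoint_left.1 hUV (h1 hz) hzV
    choose x hxA hxU using hnot
    -- Truncation forces the points into the compact set `S`. It changes no coordinate below `k`, so
    -- the untruncated subsequence has the same limit.
    obtain ⟨z, hz, φ, hφ, hlim⟩ := hS.tendsto_subseq (x := fun k i => min (x k i) (n i))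
      (fun k i _ => mem_Iic.2 (min_le_right _ _))
    have hlim' : Tendsto (fun k => x (φ k)) atTop (𝓝 z) := by
      rw [tendsto_pi_nhds] at hlim ⊢
      intro i
      refine (hlim i).congr' ?_
      filter_upwards [eventually_gt_atTop i] with k hk
      exact min_eq_left ((hA' _ _).1 (hxA (φ k)) i (hk.trans_le (hφ.id_le k)))
    have hev := hlim'.eventually ((hU.preimage hf).mem_nhds (hSU (mem_image_of_mem f hz)))
    obtain ⟨k, hk⟩ := hev.exists
    exact hxU _ hk
  refine le_trans ?_ (measure_mono hsub)
  rw [hanti.measure_iInter (fun k => isClosed_closure.measurableSet.nullMeasurableSet)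
    ⟨0, measure_ne_top _ _⟩]
  exact le_iInf fun k => (hA k).le.trans (measure_mono subset_closure)

/-- Analytic sets are universally measurable. -/
theorem MeasureTheory.AnalyticSet.nullMeasurableSet {α : Type*} [TopologicalSpace α]
    [T2Space α] [MeasurableSpace α] [OpensMeasurableSpace α] {s : Set α} (hs : AnalyticSet s)
    (μ : Measure α) [IsFiniteMeasure μ] : NullMeasurableSet s μ := by
  rcases eq_or_ne (μ s) 0 with h0 | h0
  · exact NullMeasurableSet.of_null h0
  obtain ⟨u, -, hu, hlim⟩ := exists_seq_strictMono_tendsto' (pos_iff_ne_zero.2 h0)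
  choose K hKs hKc hKm using fun n => hs.exists_isCompact_measure_ge μ (hu n).2
  have hT : MeasurableSet (⋃ n, K n) := .iUnion fun n => (hKc n).measurableSet
  have hle : μ s ≤ μ (⋃ n, K n) :=
    le_of_tendsto' hlim fun n => (hKm n).trans (measure_mono (subset_iUnion K n))
  have hTs : (⋃ n, K n) ⊆ s := iUnion_subset hKs
  have h1 : (⋃ n, K n) =ᵐ[μ] toMeasurable μ s :=
    ae_eq_of_subset_of_measure_ge (hTs.trans (subset_toMeasurable μ s))
      (by rwa [measure_toMeasurable]) hT.nullMeasurableSet (measure_ne_top _ _)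
  refine hT.nullMeasurableSet.congr ?_
  refine (hTs.eventuallyLE).antisymm ?_
  exact ((subset_toMeasurable μ s).eventuallyLE).trans h1.symm.le

/-! ### Approximation from below, and an alternative for convex cones. -/

/-- An increasing sequence of continuous functions below `F` along `e`; the supremum is the lower
semicontinuous hull of `F`, which is `∞` off the closure of the range of `e`. -/
theorem exists_continuous_approx {Z E : Type*} [TopologicalSpace E] [MetrizableSpace E]
    (e : Z → E) (F : Z → ℝ≥0∞) :
    ∃ h : ℕ → E → ℝ≥0∞, (∀ n, Continuous (h n)) ∧ Monotone h ∧ (∀ n x, h n x ≤ n) ∧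
      (∀ n w, h n (e w) ≤ F w) ∧
      (∀ w, (∀ r < F w, ∃ O, IsOpen O ∧ e w ∈ O ∧ ∀ w', e w' ∈ O → r < F w') →
        ⨆ n, h n (e w) = F w) ∧
      ∀ x ∉ closure (range e), ⨆ n, h n x = ∞ := by
  let _ := metrizableSpaceMetric E
  -- Inf-convolution with `n` times the distance, which is continuous with constant `n`. Truncation
  -- at `n` later keeps the values finite.
  let G : ℕ → E → ℝ≥0∞ := fun n x => ⨅ w, F w + n * edist x (e w)
  have hG : ∀ n, Continuous (G n) := by
    intro n
    refine _root_.continuous_of_le_add_edist n (ENNReal.natCast_ne_top n) fun x y => ?_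
    simp only [G]
    rw [ENNReal.iInf_add]
    refine le_iInf fun w => (iInf_le _ w).trans ?_
    rw [add_assoc, ← mul_add, add_comm (edist y _)]
    gcongr
    exact edist_triangle _ _ _
  -- Within distance `δ` of `x` the function `F` is at least `r`; farther away the penalty `n * δ`
  -- is, once `n` is large.
  have key : ∀ (x : E) (r : ℝ≥0∞) (δ : ℝ≥0∞), r ≠ ∞ → 0 < δ →
      (∀ w, edist x (e w) < δ → r ≤ F w) → r ≤ ⨆ n : ℕ, min (n : ℝ≥0∞) (G n x) := by
    intro x r δ hr hδ h
    obtain ⟨n, hn⟩ : ∃ n : ℕ, r ≤ n ∧ r ≤ n * δ := by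
      obtain ⟨n₁, h₁⟩ := ENNReal.exists_nat_gt hr
      obtain ⟨n₂, h₂⟩ := ENNReal.exists_nat_mul_gt hδ.ne' hr
      refine ⟨max n₁ n₂, h₁.le.trans (by exact_mod_cast le_max_left _ _), h₂.le.trans ?_⟩
      gcongr
      exact le_max_right _ _
    refine le_trans (le_min hn.1 (le_iInf fun w => ?_)) (le_iSup (fun n : ℕ => min (n : ℝ≥0∞) (G n x)) n)
    rcases lt_or_ge (edist x (e w)) δ with hw | hw
    · exact (h w hw).trans le_self_add
    · refine hn.2.trans (le_trans ?_ le_add_self)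
      gcongr
  refine ⟨fun n x => min n (G n x), fun n => continuous_const.min (hG n), ?_, fun n x =>
    min_le_left _ _, ?_, ?_, ?_⟩
  · intro a b hab x
    refine min_le_min (by exact_mod_cast hab) (iInf_mono fun w => ?_)
    gcongr
  · intro n w
    exact (min_le_right _ _).trans ((iInf_le _ w).trans (by simp))
  · intro w hw
    refine le_antisymm (iSup_le fun n => (min_le_right _ _).trans
      ((iInf_le _ w).trans (by simp))) (le_of_forall_lt fun r hr => ?_)
    obtain ⟨r', hr', hr''⟩ := exists_between hr
    obtain ⟨O, hO, hwO, h⟩ := hw r' hr''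
    obtain ⟨δ, hδ, hball⟩ := EMetric.isOpen_iff.1 hO _ hwO
    refine hr'.trans_le (key _ r' δ hr''.ne_top hδ fun w' hw' => (h w' (hball ?_)).le)
    rwa [Metric.mem_eball, edist_comm]
  · intro x hx
    obtain ⟨δ, hδ, hball⟩ := EMetric.isOpen_iff.1 isClosed_closure.isOpen_compl x hx
    refine ENNReal.eq_top_of_forall_nnreal_le fun r => key x r δ ENNReal.coe_ne_top hδ
      fun w hw => ?_
    exact absurd (subset_closure (mem_range_self w))
      (hball (by rwa [Metric.mem_eball, edist_comm]))

open scoped CompactlySupported in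
/-- A convex cone of continuous functions on a compact space either contains a strictly positive
function, or some probability measure has nonpositive integral against all of its elements. -/
theorem exists_pos_mem_or_exists_probabilityMeasure {E : Type*} [TopologicalSpace E]
    [CompactSpace E] [T2Space E] [MeasurableSpace E] [BorelSpace E] (K : ConvexCone ℝ C(E, ℝ))
    (h0 : (0 : C(E, ℝ)) ∈ K) :
    (∃ φ ∈ K, ∀ x, 0 < φ x) ∨ ∃ P : ProbabilityMeasure E, ∀ φ ∈ K, ∫ x, φ x ∂(P : Measure E) ≤ 0 := by
  rw [or_iff_not_imp_left]
  intro hno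
  push Not at hno
  let S : Set C(E, ℝ) := {φ | ∀ x, 0 < φ x}
  have hSopen : IsOpen S := by
    have : S = {φ : C(E, ℝ) | MapsTo φ univ (Ioi 0)} := by ext φ; simp [S, MapsTo]
    rw [this]
    exact ContinuousMap.isOpen_setOfPred_mapsTo isCompact_univ isOpen_Ioi
  have hSconv : Convex ℝ S := by
    intro φ hφ ψ hψ a b ha hb hab x
    have h1 := hφ x
    have h2 := hψ x
    simp only [ContinuousMap.add_apply, ContinuousMap.smul_apply, smul_eq_mul]
    rcases ha.eq_or_lt with rfl | ha'
    · have : b = 1 := by linarith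
      subst this; simpa using h2
    · have := mul_pos ha' h1
      have := mul_nonneg hb h2.le
      linarith
  obtain ⟨l, u, hlS, hlK⟩ := geometric_hahn_banach_open hSconv hSopen K.convex
    (disjoint_left.2 fun φ hφ hK => by
      obtain ⟨x, hx⟩ := hno φ hK
      exact absurd (hφ x) (not_lt.2 hx))
  have hu : u ≤ 0 := by simpa using hlK 0 h0
  have hKl : ∀ φ ∈ K, 0 ≤ l φ := by
    intro φ hφ
    by_contra! hneg
    -- With this factor the multiple of `φ` has `l`-value `u - 1`, below the bound `u` valid on the
    -- cone.
    have hc : 0 < (-u + 1) / (-l φ) := div_pos (by linarith) (by linarith)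
    have := hlK _ (K.smul_mem hc hφ)
    rw [map_smul, smul_eq_mul, div_mul_eq_mul_div, le_div_iff₀ (by linarith)] at this
    nlinarith
  have h1 : l 1 < 0 := (hlS 1 fun x => by simp).trans_le hu
  have hpos : ∀ φ : C(E, ℝ), (∀ x, 0 ≤ φ x) → l φ ≤ 0 := by
    intro φ hφ
    by_contra! hlt
    have hc : 0 < l φ / (-l 1) := div_pos hlt (by linarith)
    have := hlS (φ + (l φ / (-l 1)) • 1) fun x => by
      have := hφ x
      simp only [ContinuousMap.add_apply, ContinuousMap.smul_apply, ContinuousMap.one_apply,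
        smul_eq_mul, mul_one]
      linarith
    rw [map_add, map_smul, smul_eq_mul, div_mul_eq_mul_div, mul_div_assoc, div_neg,
      div_self h1.ne] at this
    linarith
  -- The separating functional is nonpositive on nonnegative functions, so division by `l 1 < 0`
  -- makes it positive with value `1` at `1`.
  let Λ : C_c(E, ℝ) →ₚ[ℝ] ℝ :=
    { toFun := fun φ => l φ.toContinuousMap / l 1
      map_add' := fun φ ψ => by
        rw [show (φ + ψ).toContinuousMap = φ.toContinuousMap + ψ.toContinuousMap from rfl, map_add,
          add_div]
      map_smul' := fun c φ => by
        rw [show (c • φ).toContinuousMap = c • φ.toContinuousMap from rfl, map_smul]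
        simp [mul_div_assoc]
      monotone' := fun φ ψ h => by
        have := hpos (ψ.toContinuousMap - φ.toContinuousMap) fun x => sub_nonneg.2 (h x)
        rw [map_sub] at this
        exact div_le_div_of_nonpos_of_le h1.le (by linarith) }
  have hint : ∀ φ : C(E, ℝ), ∫ x, φ x ∂(RealRMK.rieszMeasure Λ) = l φ / l 1 := fun φ =>
    RealRMK.integral_rieszMeasure Λ ⟨φ, HasCompactSupport.of_compactSpace φ⟩
  have hprob : IsProbabilityMeasure (RealRMK.rieszMeasure Λ) := by
    have := hint 1
    rw [div_self h1.ne] at this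
    simp only [ContinuousMap.one_apply, integral_const, smul_eq_mul, mul_one, Measure.real] at this
    exact ⟨(ENNReal.toReal_eq_one_iff _).1 this⟩
  refine ⟨⟨RealRMK.rieszMeasure Λ, hprob⟩, fun φ hφ => ?_⟩
  rw [ProbabilityMeasure.coe_mk, hint]
  exact div_nonpos_of_nonneg_of_nonpos (hKl φ hφ) h1.le

/-! ### Integrals of extended real functions bounded from below. -/

namespace WeakTransport

/-- Shifting by a lower bound reduces every later integral to a single one with values in `[0, ∞]`,
where no difference of infinities can occur. -/
theorem eintegral_eq_lintegral_add {Z : Type*} [MeasurableSpace Z] {m : Measure Z}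
    [IsProbabilityMeasure m] {f : Z → EReal} (hf : AEMeasurable f m) {c : ℝ}
    (hc : ∀ z, (c : EReal) ≤ f z) :
    eintegral m f = ((∫⁻ z, (f z - c).toENNReal ∂m : ℝ≥0∞) : EReal) + c := by
  -- The identity `f - c = f⁺ - f⁻ - c`, arranged so that only sums of nonnegative terms appear.
  have hpt : ∀ z, (f z - c).toENNReal + (-f z).toENNReal + ENNReal.ofReal c =
      (f z).toENNReal + ENNReal.ofReal (-c) := by
    intro z
    have h := hc z
    induction hz : f z with
    | bot => simp [hz] at h
    | top => simp
    | coe a =>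
      rw [hz, EReal.coe_le_coe_iff] at h
      rw [← EReal.coe_sub, ← EReal.coe_neg]
      simp only [EReal.toENNReal_of_ne_top (EReal.coe_ne_top _), EReal.toReal_coe]
      rcases le_total 0 a with ha | ha <;> rcases le_total 0 c with hc' | hc'
      · rw [ENNReal.ofReal_of_nonpos (p := -a) (by linarith), ENNReal.ofReal_of_nonpos (p := -c)
          (by linarith), add_zero, add_zero, ← ENNReal.ofReal_add (by linarith) hc']
        simp
      · rw [ENNReal.ofReal_of_nonpos (p := -a) (by linarith), ENNReal.ofReal_of_nonpos (p := c)
          (by linarith), add_zero, add_zero, ← ENNReal.ofReal_add ha (by linarith)]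
        ring_nf
      · have : a = 0 := by linarith
        have : c = 0 := by linarith
        subst_vars; simp
      · rw [ENNReal.ofReal_of_nonpos (p := a) ha, ENNReal.ofReal_of_nonpos (p := c) hc', add_zero,
          zero_add, ← ENNReal.ofReal_add (by linarith) (by linarith)]
        ring_nf
  have hneg : ∀ z, (-f z).toENNReal ≤ ENNReal.ofReal (-c) := fun z => by
    refine (EReal.toENNReal_le_toENNReal (EReal.neg_le_neg_iff.2 (hc z))).trans ?_
    rw [← EReal.coe_neg, EReal.toENNReal_of_ne_top (EReal.coe_ne_top _), EReal.toReal_coe]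
  have hm1 : AEMeasurable (fun z => (f z).toENNReal) m := by fun_prop
  have hm2 : AEMeasurable (fun z => (-f z).toENNReal) m := by fun_prop
  have hint : (∫⁻ z, (f z - c).toENNReal ∂m) + (∫⁻ z, (-f z).toENNReal ∂m) + ENNReal.ofReal c =
      (∫⁻ z, (f z).toENNReal ∂m) + ENNReal.ofReal (-c) := by
    have h := lintegral_congr (μ := m) hpt
    rw [lintegral_add_right _ measurable_const, lintegral_add_right _ measurable_const,
      lintegral_add_right' _ hm2] at h
    simpa using h
  have hB : ∫⁻ z, (-f z).toENNReal ∂m ≤ ENNReal.ofReal (-c) :=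
    (lintegral_mono hneg).trans (by simp)
  have hcc : c = (ENNReal.ofReal c).toReal - (ENNReal.ofReal (-c)).toReal := by
    rw [ENNReal.toReal_ofReal', ENNReal.toReal_ofReal']
    rcases le_total 0 c with h | h
    · rw [max_eq_left h, max_eq_right (by linarith), sub_zero]
    · rw [max_eq_right h, max_eq_left (by linarith)]; ring
  rw [eintegral]
  generalize (∫⁻ z, (f z - c).toENNReal ∂m) = G at hint ⊢
  generalize (∫⁻ z, (f z).toENNReal ∂m) = A at hint ⊢
  generalize (∫⁻ z, (-f z).toENNReal ∂m) = B at hint hB ⊢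
  have hBt : B ≠ ∞ := (hB.trans_lt ENNReal.ofReal_lt_top).ne
  rcases eq_or_ne G ∞ with rfl | hG
  · have : A = ∞ := by simpa using hint.symm
    subst this
    rw [← ENNReal.ofReal_toReal hBt]
    simp only [EReal.coe_ennreal_ofReal, EReal.coe_ennreal_top]
    rw [EReal.top_sub_coe, EReal.top_add_coe]
  · have hA : A ≠ ∞ := by
      rintro rfl
      simp [hG, hBt] at hint
    rw [← ENNReal.ofReal_toReal hG, ← ENNReal.ofReal_toReal hA, ← ENNReal.ofReal_toReal hBt]
    simp only [EReal.coe_ennreal_ofReal, max_eq_left ENNReal.toReal_nonneg]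
    rw [← EReal.coe_sub, ← EReal.coe_add, EReal.coe_eq_coe_iff]
    have := congrArg ENNReal.toReal hint
    rw [ENNReal.toReal_add (by simp [hG, hBt]) (by simp), ENNReal.toReal_add hG hBt,
      ENNReal.toReal_add hA (by simp)] at this
    linarith

end WeakTransport

end

/-! ### Measurable structure of spaces of probability measures. -/

section

open Filter Topology TopologicalSpace

theorem PolishSpace.of_compactSpace_metrizableSpace (K : Type*) [TopologicalSpace K]
    [CompactSpace K] [MetrizableSpace K] : PolishSpace K := by
  let _ := metrizableSpaceMetric K
  infer_instance

theorem MeasurableEmbedding.standardBorelSpace_of_range {α β : Type*} [MeasurableSpace α]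
    [MeasurableSpace β] [StandardBorelSpace β] {f : α → β} (hf : MeasurableEmbedding f) :
    StandardBorelSpace α := by
  have := hf.measurableSet_range.standardBorel
  let e : α ≃ᵐ range f := hf.equivRange
  let _ := upgradeStandardBorel (range f)
  let _ : TopologicalSpace α := induced e inferInstance
  refine ⟨inferInstance, ⟨?_⟩, e.toEquiv.polishSpace_induced⟩
  rw [borel_comap, ← BorelSpace.measurable_eq (α := range f)]
  exact e.measurableEmbedding.comap_eq.symm

namespace MeasureTheory.ProbabilityMeasure

theorem measurable_toMeasure {Y : Type*} [MeasurableSpace Y] :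
    Measurable (fun p : ProbabilityMeasure Y => (p : Measure Y)) := measurable_subtype_coe

theorem measurable_apply {Y : Type*} [MeasurableSpace Y] {s : Set Y} (hs : MeasurableSet s) :
    Measurable fun p : ProbabilityMeasure Y => (p : Measure Y) s :=
  (Measure.measurable_coe hs).comp measurable_toMeasure

theorem measurable_of_measurable_toMeasure {X Y : Type*} [MeasurableSpace X] [MeasurableSpace Y]
    {f : X → ProbabilityMeasure Y} (hf : Measurable fun x => (f x : Measure Y)) : Measurable f :=
  Measurable.subtype_mk hf

theorem measurable_lintegral {Y : Type*} [MeasurableSpace Y] {f : Y → ℝ≥0∞} (hf : Measurable f) :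
    Measurable fun p : ProbabilityMeasure Y => ∫⁻ y, f y ∂(p : Measure Y) :=
  (Measure.measurable_lintegral hf).comp measurable_toMeasure

/-- The identity, seen as a Markov kernel from the space of probability measures on `Y` to `Y`. -/
noncomputable def evalKernel (Y : Type*) [MeasurableSpace Y] :
    ProbabilityTheory.Kernel (ProbabilityMeasure Y) Y :=
  ⟨fun p => p, measurable_toMeasure⟩

instance (Y : Type*) [MeasurableSpace Y] : ProbabilityTheory.IsMarkovKernel (evalKernel Y) :=
  ⟨fun p => inferInstanceAs (IsProbabilityMeasure (p : Measure Y))⟩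

theorem measurable_integral {Y : Type*} [MeasurableSpace Y] {f : Y → ℝ} (hf : Measurable f) :
    Measurable fun p : ProbabilityMeasure Y => ∫ y, f y ∂(p : Measure Y) :=
  (hf.stronglyMeasurable.integral_kernel (κ := evalKernel Y)).measurable

section Compact

variable {K : Type*} [TopologicalSpace K] [CompactSpace K] [MeasurableSpace K] [BorelSpace K]

theorem eq_generateFrom_integral :
    (inferInstance : TopologicalSpace (ProbabilityMeasure K)) =
      generateFrom {s | ∃ (g : C(K, ℝ)) (V : Set ℝ), IsOpen V ∧
        s = {p : ProbabilityMeasure K | ∫ x, g x ∂(p : Measure K) ∈ V}} := by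
  apply le_antisymm
  · refine le_generateFrom ?_
    rintro s ⟨g, V, hV, rfl⟩
    exact hV.preimage (continuous_integral_continuousMap g)
  · rw [← continuous_id_iff_le]
    let _ := generateFrom {s | ∃ (g : C(K, ℝ)) (V : Set ℝ), IsOpen V ∧
        s = {p : ProbabilityMeasure K | ∫ x, g x ∂(p : Measure K) ∈ V}}
    refine continuous_iff_forall_continuousMap_continuous_integral.2 fun g => ?_
    refine continuous_def.2 fun V hV => isOpen_generateFrom_of_mem ⟨g, V, hV, rfl⟩

/-- Evaluations at closed sets are limits of weakly continuous integrals, hence weakly Borel.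
Conversely the weak topology is second countable, so its Borel sets are generated by the subbasic
sets, which are measurable for the evaluations. -/
instance borelSpace_of_compactSpace [MetrizableSpace K] : BorelSpace (ProbabilityMeasure K) := by
  constructor
  apply le_antisymm
  · have h : @Measurable (ProbabilityMeasure K) (ProbabilityMeasure K) (borel _) _ id := by
      let _ : MeasurableSpace (ProbabilityMeasure K) := borel _
      have : BorelSpace (ProbabilityMeasure K) := ⟨rfl⟩
      have hm : Measurable fun p : ProbabilityMeasure K => (p : Measure K) := by
        refine Measurable.measure_of_isPiSystem_of_isProbabilityMeasure
          (BorelSpace.measurable_eq.trans borel_eq_generateFrom_isClosed) isPiSystem_isClosed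
          fun F hF => ?_
        have hlim : ∀ p : ProbabilityMeasure K, Tendsto
            (fun n => ∫⁻ x, hF.apprSeq n x ∂(p : Measure K)) atTop (𝓝 ((p : Measure K) F)) :=
          fun p => HasOuterApproxClosed.tendsto_lintegral_apprSeq hF _
        refine measurable_of_tendsto_metrizable (fun n => ?_) (tendsto_pi_nhds.2 hlim)
        exact (continuous_lintegral_boundedContinuousFunction _).measurable
      exact Measurable.subtype_mk hm
    exact fun s hs => h hs
  · have hsc : SecondCountableTopology (ProbabilityMeasure K) := inferInstance
    rw [borel_eq_generateFrom_of_subbasis eq_generateFrom_integral]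
    refine MeasurableSpace.generateFrom_le ?_
    rintro s ⟨g, V, hV, rfl⟩
    exact measurable_integral g.continuous.measurable hV.measurableSet

end Compact

section Embedding

variable {Y K : Type*} [MeasurableSpace Y] [MeasurableSpace K]

theorem measurable_map {i : Y → K} (hi : Measurable i) :
    Measurable fun p : ProbabilityMeasure Y => p.map hi.aemeasurable :=
  measurable_of_measurable_toMeasure ((Measure.measurable_map i hi).comp measurable_toMeasure)

theorem range_map {i : Y → K} (hi : MeasurableEmbedding i) :
    (range fun p : ProbabilityMeasure Y => p.map hi.measurable.aemeasurable) =
      {u : ProbabilityMeasure K | (u : Measure K) (range i) = 1} := by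
  ext u
  constructor
  · rintro ⟨p, rfl⟩
    change (p.map hi.measurable.aemeasurable).toMeasure (range i) = 1
    rw [toMeasure_map, hi.map_apply, preimage_range, measure_univ]
  · intro hu
    have h1 : (u : Measure K) (range i) = 1 := hu
    refine ⟨⟨(u : Measure K).comap i, ⟨by rw [hi.comap_apply, image_univ, h1]⟩⟩, ?_⟩
    apply toMeasure_injective
    change Measure.map i ((u : Measure K).comap i) = u
    rw [hi.map_comap]
    refine Measure.restrict_eq_self_of_ae_mem ?_
    rw [← prob_compl_eq_zero_iff hi.measurableSet_range] at h1
    exact h1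

/-- The inverse is `comap` on the measurable set of laws carried by `range i`. Elsewhere it takes a
Dirac mass as a harmless default. -/
theorem measurableEmbedding_map [Nonempty Y] {i : Y → K} (hi : MeasurableEmbedding i) :
    MeasurableEmbedding fun p : ProbabilityMeasure Y => p.map hi.measurable.aemeasurable := by
  classical
  let y₀ : Y := Classical.arbitrary Y
  let B : Set (ProbabilityMeasure K) := {u | (u : Measure K) (range i) = 1}
  have hB : MeasurableSet B :=
    measurable_apply hi.measurableSet_range (measurableSet_singleton 1)
  let gm : ProbabilityMeasure K → Measure Y := fun u =>
    if u ∈ B then (u : Measure K).comap i else Measure.dirac y₀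
  have hgm : ∀ u ∈ B, gm u = (u : Measure K).comap i := fun u hu => if_pos hu
  have hprob : ∀ u, IsProbabilityMeasure (gm u) := fun u => by
    by_cases hu : u ∈ B
    · refine ⟨?_⟩
      rw [hgm u hu, hi.comap_apply, image_univ]
      exact hu
    · simp only [gm, if_neg hu]
      infer_instance
  let g : ProbabilityMeasure K → ProbabilityMeasure Y := fun u => ⟨gm u, hprob u⟩
  have hg : Measurable g := by
    refine Measurable.subtype_mk (Measure.measurable_of_measurable_coe _ fun s hs => ?_)
    have : (fun u => gm u s) =
        fun u => if u ∈ B then (u : Measure K) (i '' s) else Measure.dirac y₀ s := by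
      ext u
      by_cases hu : u ∈ B <;> simp [gm, hu, hi.comap_apply]
    rw [this]
    exact Measurable.ite hB (measurable_apply (hi.measurableSet_image.2 hs))
      measurable_const
  have hleft : Function.LeftInverse g fun p => p.map hi.measurable.aemeasurable := fun p => by
    apply toMeasure_injective
    refine (hgm _ ?_).trans (hi.comap_map _)
    exact (range_map hi).subset (mem_range_self p)
  exact MeasurableEmbedding.of_measurable_inverse (measurable_map hi.measurable)
    ((range_map hi).symm ▸ hB) hg hleft

end Embedding

/-- The laws on the Hilbert cube form a compact metrizable space, and an embedding of `Y` in the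
cube makes the laws on `Y` a measurable subset of it. Disintegration over `P(Y)` and the projection
argument both need this. -/
theorem standardBorelSpace {Y : Type*} [TopologicalSpace Y] [PolishSpace Y] [MeasurableSpace Y]
    [BorelSpace Y] [Nonempty Y] : StandardBorelSpace (ProbabilityMeasure Y) := by
  let _ := upgradeIsCompletelyMetrizable Y
  obtain ⟨i, hi⟩ := Metric.PiNatEmbed.exists_embedding_to_hilbert_cube (X := Y)
  have := PolishSpace.of_compactSpace_metrizableSpace (ProbabilityMeasure (ℕ → unitInterval))
  exact (measurableEmbedding_map (hi.continuous.measurableEmbedding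
    hi.injective)).standardBorelSpace_of_range

/-- The intensity of a law `Q` on the space of probability measures on `Y`. -/
theorem lintegral_evalKernel_comp {Y : Type*} [MeasurableSpace Y]
    (Q : Measure (ProbabilityMeasure Y)) {f : Y → ℝ≥0∞} (hf : Measurable f) :
    ∫⁻ y, f y ∂(Q.bind (evalKernel Y)) = ∫⁻ p, ∫⁻ y, f y ∂(p : Measure Y) ∂Q :=
  Measure.lintegral_bind (evalKernel Y).measurable.aemeasurable hf.aemeasurable

end MeasureTheory.ProbabilityMeasure

end

/-! ### Moments, and upper bounds for `W_t` from explicit transport kernels. -/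

section

open Filter Topology TopologicalSpace ProbabilityTheory

theorem MeasureTheory.ProbabilityMeasure.continuous_lintegral_of_ne_top {K : Type*}
    [TopologicalSpace K] [CompactSpace K] [MeasurableSpace K] [BorelSpace K] {g : K → ℝ≥0∞}
    (hg : Continuous g) (hfin : ∀ x, g x ≠ ∞) :
    Continuous fun u : ProbabilityMeasure K => ∫⁻ x, g x ∂(u : Measure K) := by
  have hc : Continuous fun x => (g x).toNNReal :=
    ENNReal.continuousOn_toNNReal.comp_continuous hg hfin
  have := continuous_lintegral_continuousMap (X := K) (⟨_, hc⟩ : C(K, NNReal))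
  simpa only [ContinuousMap.coe_mk, ENNReal.coe_toNNReal (hfin _)] using this

namespace WeakTransport

section Moment

variable {Y : Type*} [MetricSpace Y]

/-- The moment `∫ d(y, y₀)^t p(dy)`. -/
noncomputable def moment [MeasurableSpace Y] (t : ℝ) (y₀ : Y) (p : ProbabilityMeasure Y) : ℝ≥0∞ :=
  ∫⁻ y, edist y y₀ ^ t ∂(p : Measure Y)

variable {t : ℝ}

theorem edist_rpow_le (ht : 1 ≤ t) (y z y₀ : Y) :
    edist y z ^ t ≤ 2 ^ (t - 1) * (edist y y₀ ^ t + edist z y₀ ^ t) :=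
  (ENNReal.rpow_le_rpow (edist_triangle_right y z y₀) (by linarith)).trans
    (ENNReal.rpow_add_le_mul_rpow_add_rpow _ _ ht)

theorem two_rpow_ne_top (t : ℝ) : (2 : ℝ≥0∞) ^ t ≠ ∞ :=
  ENNReal.rpow_ne_top_of_ne_zero (by simp) (by simp)

theorem moment_lt_top_of_hasFiniteMoment [MeasurableSpace Y] (ht : 1 ≤ t) {p : ProbabilityMeasure Y}
    (hp : HasFiniteMoment t p) (y₀ : Y) : moment t y₀ p < ∞ := by
  obtain ⟨y₁, h₁⟩ := hp
  calc moment t y₀ p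
      ≤ ∫⁻ y, 2 ^ (t - 1) * (edist y y₁ ^ t + edist y₀ y₁ ^ t) ∂(p : Measure Y) :=
        lintegral_mono fun y => edist_rpow_le ht _ _ _
    _ = 2 ^ (t - 1) * ((∫⁻ y, edist y y₁ ^ t ∂(p : Measure Y)) + edist y₀ y₁ ^ t) := by
        rw [lintegral_const_mul' _ _ (two_rpow_ne_top _), lintegral_add_right _ measurable_const]
        simp
    _ < ∞ := ENNReal.mul_lt_top (two_rpow_ne_top _).lt_top
        (ENNReal.add_lt_top.2 ⟨h₁, ENNReal.rpow_lt_top_of_nonneg (by linarith) (edist_ne_top _ _)⟩)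

theorem hasFiniteMoment_iff [MeasurableSpace Y] (ht : 1 ≤ t) (y₀ : Y) (p : ProbabilityMeasure Y) :
    HasFiniteMoment t p ↔ moment t y₀ p < ∞ :=
  ⟨fun h => moment_lt_top_of_hasFiniteMoment ht h y₀, fun h => ⟨y₀, h⟩⟩

end Moment

section Gluing

variable {Y : Type*} [MetricSpace Y] [SecondCountableTopology Y] [MeasurableSpace Y] [BorelSpace Y]
  {t : ℝ}

/-- Triangle inequality for the Wasserstein distance: the second coupling is given by a kernel. -/
theorem wassersteinDist_le_add (ht : 1 ≤ t) {p₀ p q : ProbabilityMeasure Y}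
    {π : ProbabilityMeasure (Y × Y)} (hπ : π ∈ couplings p₀ p) (κ : Kernel Y Y) [IsMarkovKernel κ]
    (hκ : (p : Measure Y).bind κ = q) :
    wassersteinDist t p₀ q ≤ (∫⁻ z, edist z.1 z.2 ^ t ∂(π : Measure (Y × Y))) ^ (1 / t) +
      (∫⁻ y, ∫⁻ z, edist y z ^ t ∂(κ y) ∂(p : Measure Y)) ^ (1 / t) := by
  have ht0 : 0 < t := by linarith
  let κ' : Kernel (Y × Y) Y := κ.comap Prod.snd measurable_snd
  -- The joint law of three points, gluing `π` to `κ` along `p`. Its outer marginal is the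
  -- competitor, and the bound is Minkowski's inequality in `L^t(Γ)`.
  let Γ : Measure ((Y × Y) × Y) := (π : Measure (Y × Y)) ⊗ₘ κ'
  have hm : Measurable fun w : (Y × Y) × Y => (w.1.1, w.2) := by fun_prop
  let γ : ProbabilityMeasure (Y × Y) :=
    ⟨Γ.map fun w => (w.1.1, w.2), Measure.isProbabilityMeasure_map hm.aemeasurable⟩
  have hγ : γ ∈ couplings p₀ q := by
    constructor
    · change (Γ.map fun w => (w.1.1, w.2)).map Prod.fst = _
      rw [Measure.map_map measurable_fst hm, ← hπ.1]
      change Γ.map (Prod.fst ∘ Prod.fst) = _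
      rw [← Measure.map_map measurable_fst measurable_fst]
      congr 1
      exact Measure.fst_compProd _ _
    · change (Γ.map fun w => (w.1.1, w.2)).map Prod.snd = _
      rw [Measure.map_map measurable_snd hm]
      change Γ.snd = _
      rw [Measure.snd_compProd, ← hκ, ← hπ.2]
      ext s hs
      rw [Measure.bind_apply hs κ'.measurable.aemeasurable,
        Measure.bind_apply hs κ.measurable.aemeasurable,
        lintegral_map (κ.measurable_coe hs) measurable_snd]
      rfl
  have h1 : wassersteinDist t p₀ q ≤ (∫⁻ w, edist w.1.1 w.2 ^ t ∂Γ) ^ (1 / t) := by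
    refine ENNReal.rpow_le_rpow ((iInf₂_le γ hγ).trans_eq ?_) (by positivity)
    change ∫⁻ z, edist z.1 z.2 ^ t ∂(Γ.map fun w => (w.1.1, w.2)) = _
    rw [lintegral_map (by fun_prop) hm]
  have h2 : (∫⁻ w, edist w.1.1 w.2 ^ t ∂Γ) ^ (1 / t) ≤
      (∫⁻ w, edist w.1.1 w.1.2 ^ t ∂Γ) ^ (1 / t) + (∫⁻ w, edist w.1.2 w.2 ^ t ∂Γ) ^ (1 / t) := by
    refine le_trans (ENNReal.rpow_le_rpow (lintegral_mono fun w => ?_) (by positivity))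
      (ENNReal.lintegral_Lp_add_le (f := fun w : (Y × Y) × Y => edist w.1.1 w.1.2)
        (g := fun w : (Y × Y) × Y => edist w.1.2 w.2) (by fun_prop) (by fun_prop) ht)
    exact ENNReal.rpow_le_rpow (edist_triangle _ _ _) ht0.le
  have h3 : ∫⁻ w, edist w.1.1 w.1.2 ^ t ∂Γ = ∫⁻ z, edist z.1 z.2 ^ t ∂(π : Measure (Y × Y)) := by
    rw [Measure.lintegral_compProd (by fun_prop)]
    simp
  have h4 : ∫⁻ w, edist w.1.2 w.2 ^ t ∂Γ =
      ∫⁻ y, ∫⁻ z, edist y z ^ t ∂(κ y) ∂(p : Measure Y) := by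
    have hmeas : Measurable fun y => ∫⁻ z, edist y z ^ t ∂(κ y) :=
      Measurable.lintegral_kernel_prod_right' (f := fun w : Y × Y => edist w.1 w.2 ^ t)
        (by fun_prop)
    rw [Measure.lintegral_compProd (by fun_prop), ← hπ.2, lintegral_map hmeas measurable_snd]
    rfl
  rw [h3, h4] at h2
  exact h1.trans h2

/-- A density on the product with unit marginals gives a kernel between the marginals. -/
theorem wassersteinDist_le_add_of_density (ht : 1 ≤ t) {p₀ p q : ProbabilityMeasure Y}
    {π : ProbabilityMeasure (Y × Y)} (hπ : π ∈ couplings p₀ p) {k : Y → Y → ℝ≥0∞}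
    (hk : Measurable (Function.uncurry k)) (hkq : ∀ y, ∫⁻ z, k y z ∂(q : Measure Y) = 1)
    (hkp : ∀ z, ∫⁻ y, k y z ∂(p : Measure Y) = 1) :
    wassersteinDist t p₀ q ≤ (∫⁻ z, edist z.1 z.2 ^ t ∂(π : Measure (Y × Y))) ^ (1 / t) +
      (∫⁻ y, ∫⁻ z, k y z * edist y z ^ t ∂(q : Measure Y) ∂(p : Measure Y)) ^ (1 / t) := by
  let κ : Kernel Y Y := (Kernel.const Y (q : Measure Y)).withDensity k
  have hκ : ∀ y, κ y = (q : Measure Y).withDensity (k y) := fun y => by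
    rw [Kernel.withDensity_apply _ hk, Kernel.const_apply]
  have hky : ∀ y, Measurable (k y) := fun y => hk.comp (measurable_const.prodMk measurable_id)
  have : IsMarkovKernel κ := ⟨fun y => ⟨by
    rw [hκ, withDensity_apply _ .univ, Measure.restrict_univ, hkq]⟩⟩
  have hbind : (p : Measure Y).bind κ = q := by
    ext s hs
    rw [Measure.bind_apply hs κ.measurable.aemeasurable]
    simp_rw [hκ, withDensity_apply _ hs]
    rw [lintegral_lintegral_swap hk.aemeasurable]
    simp [hkp]
  refine (wassersteinDist_le_add ht hπ κ hbind).trans_eq ?_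
  congr 3
  funext y
  rw [hκ, lintegral_withDensity_eq_lintegral_mul _ (hky y) (by fun_prop)]
  rfl

end Gluing

/-- The last term of the pointwise bound is a sum of products. Since `U` and `V` have the same mass
`ρ`, the factor `ρ⁻¹` normalises and leaves one weighted integral of `F` for each marginal. -/
theorem lintegral_density_mul_le {Y : Type*} [MeasurableSpace Y] {p q : ProbabilityMeasure Y}
    {k c : Y → Y → ℝ≥0∞} (hk : Measurable (Function.uncurry k))
    (hkq : ∀ y, ∫⁻ z, k y z ∂(q : Measure Y) = 1) {F U V : Y → ℝ≥0∞} (hF : Measurable F)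
    (hU : Measurable U) (hV : Measurable V) {D A ρ : ℝ≥0∞} (hρ0 : ρ ≠ 0) (hρt : ρ ≠ ∞)
    (hUp : ∫⁻ y, U y ∂(p : Measure Y) = ρ) (hVq : ∫⁻ z, V z ∂(q : Measure Y) = ρ)
    (h : ∀ y z, k y z * c y z ≤ D * k y z + A * (ρ⁻¹ * (F y * U y * V z + U y * (F z * V z)))) :
    ∫⁻ y, ∫⁻ z, k y z * c y z ∂(q : Measure Y) ∂(p : Measure Y) ≤
      D + A * ((∫⁻ y, F y * U y ∂(p : Measure Y)) + ∫⁻ z, F z * V z ∂(q : Measure Y)) := by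
  have hin : ∀ y, ∫⁻ z, k y z * c y z ∂(q : Measure Y) ≤
      D + A * (F y * U y + ρ⁻¹ * U y * ∫⁻ z, F z * V z ∂(q : Measure Y)) := by
    intro y
    have hky : Measurable (k y) := hk.comp (measurable_const.prodMk measurable_id)
    refine (lintegral_mono (h y)).trans_eq ?_
    rw [lintegral_add_right _ (by fun_prop), lintegral_const_mul _ hky, hkq,
      lintegral_const_mul _ (by fun_prop), lintegral_const_mul _ (by fun_prop),
      lintegral_add_right _ (by fun_prop), lintegral_const_mul _ (by fun_prop),
      lintegral_const_mul _ (by fun_prop), hVq, mul_one, mul_add ρ⁻¹, mul_comm _ ρ, ← mul_assoc,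
      ENNReal.inv_mul_cancel hρ0 hρt, one_mul, mul_assoc ρ⁻¹]
  refine (lintegral_mono hin).trans_eq ?_
  rw [lintegral_add_right _ (by fun_prop), lintegral_const, measure_univ, mul_one,
    lintegral_const_mul _ (by fun_prop), lintegral_add_right _ (by fun_prop),
    lintegral_mul_const _ (by fun_prop), lintegral_const_mul _ (by fun_prop), hUp,
    ENNReal.inv_mul_cancel hρ0 hρt, one_mul]

section Partition

variable {Y : Type*} [MetricSpace Y] [SecondCountableTopology Y] [MeasurableSpace Y] [BorelSpace Y]
  {t : ℝ}

/-- From `p` to `q`, a fraction `θ` of the mass in each cell moves inside that cell, at distance at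
most `δ`. The remainders are coupled independently and cost at most their moments. The condition `θ
* a j ≤ b j` says that `q` has room for the mass it receives. -/
theorem wassersteinDist_le_add_of_partition (ht : 1 ≤ t) {p₀ p q : ProbabilityMeasure Y}
    {π : ProbabilityMeasure (Y × Y)} (hπ : π ∈ couplings p₀ p) {ι : Type*} [Fintype ι]
    {φ : ι → Y → ℝ≥0∞} (hφ : ∀ j, Measurable (φ j)) (hφ1 : ∀ y, ∑ j, φ j y ≤ 1) {δ : ℝ≥0∞}
    (hδ : ∀ j y z, φ j y ≠ 0 → φ j z ≠ 0 → edist y z ≤ δ) {θ : ℝ≥0∞} (hθ : θ < 1) {a b : ι → ℝ≥0∞}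
    (ha : ∀ j, ∫⁻ y, φ j y ∂(p : Measure Y) = a j) (hb : ∀ j, ∫⁻ y, φ j y ∂(q : Measure Y) = b j)
    (hb0 : ∀ j, b j ≠ 0) (hab : ∀ j, θ * a j ≤ b j) (y₀ : Y) :
    wassersteinDist t p₀ q ≤ (∫⁻ z, edist z.1 z.2 ^ t ∂(π : Measure (Y × Y))) ^ (1 / t) +
      (δ ^ t + 2 ^ (t - 1) *
        ((∫⁻ y, edist y y₀ ^ t * (1 - θ * ∑ j, φ j y) ∂(p : Measure Y)) +
          ∫⁻ z, edist z y₀ ^ t * (1 - θ * ∑ j, a j / b j * φ j z) ∂(q : Measure Y))) ^ (1 / t) := by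
  have ht0 : 0 < t := by linarith
  have hφle : ∀ j y, φ j y ≤ 1 := fun j y =>
    (Finset.single_le_sum (f := fun j => φ j y) (fun _ _ => zero_le) (Finset.mem_univ j)).trans
      (hφ1 y)
  have hbt : ∀ j, b j ≠ ∞ := fun j => by
    rw [← hb]
    exact ((lintegral_mono (hφle j)).trans_lt (by simp)).ne
  have hat : ∀ j, a j ≠ ∞ := fun j => by
    rw [← ha]
    exact ((lintegral_mono (hφle j)).trans_lt (by simp)).ne
  let u : Y → ℝ≥0∞ := fun y => θ * ∑ j, φ j y
  let v : Y → ℝ≥0∞ := fun z => θ * ∑ j, a j / b j * φ j z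
  have hu : Measurable u := by fun_prop
  have hv : Measurable v := by fun_prop
  have hu1 : ∀ y, u y ≤ 1 := fun y => (mul_le_mul' hθ.le (hφ1 y)).trans (by simp)
  have hv1 : ∀ z, v z ≤ 1 := fun z => by
    refine le_trans ?_ (hφ1 z)
    simp only [v, Finset.mul_sum]
    refine Finset.sum_le_sum fun j _ => ?_
    rw [← mul_assoc, ← mul_div_assoc]
    exact mul_le_of_le_one_left' (ENNReal.div_le_of_le_mul (by simpa using hab j))
  let m : ℝ≥0∞ := θ * ∑ j, a j
  have hsum : ∑ j, a j ≤ 1 := by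
    simp_rw [← ha]
    rw [← lintegral_finsetSum _ fun j _ => hφ j]
    exact (lintegral_mono hφ1).trans (by simp)
  have hm : m < 1 := lt_of_le_of_lt ((mul_le_mul_right hsum θ).trans (by simp)) hθ
  -- The mass not moved within cells, the same for both marginals. It is positive because `θ < 1`,
  -- so dividing by it is legitimate.
  let ρ : ℝ≥0∞ := 1 - m
  have hρ0 : ρ ≠ 0 := (tsub_pos_of_lt hm).ne'
  have hρt : ρ ≠ ∞ := ENNReal.sub_ne_top (by simp)
  have hintu : ∫⁻ y, u y ∂(p : Measure Y) = m := by
    simp only [u, m]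
    rw [lintegral_const_mul _ (by fun_prop), lintegral_finsetSum _ fun j _ => hφ j]
    simp_rw [ha]
  have hintv : ∫⁻ y, v y ∂(q : Measure Y) = m := by
    simp only [v, m]
    rw [lintegral_const_mul _ (by fun_prop), lintegral_finsetSum _ fun j _ => by fun_prop]
    congr 1
    refine Finset.sum_congr rfl fun j _ => ?_
    rw [lintegral_const_mul _ (hφ j), hb, ENNReal.div_mul_cancel (hb0 j) (hbt j)]
  have hint1u : ∫⁻ y, (1 - u y) ∂(p : Measure Y) = ρ := by
    rw [lintegral_sub hu (by rw [hintu]; exact hm.ne_top) (ae_of_all _ hu1), hintu]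
    simp [ρ]
  have hint1v : ∫⁻ y, (1 - v y) ∂(q : Measure Y) = ρ := by
    rw [lintegral_sub hv (by rw [hintv]; exact hm.ne_top) (ae_of_all _ hv1), hintv]
    simp [ρ]
  -- The sum is the motion within cells, the last term the independent coupling of the remainders `1
  -- - u` and `1 - v`.
  let k : Y → Y → ℝ≥0∞ := fun y z =>
    (∑ j, θ * (b j)⁻¹ * (φ j y * φ j z)) + ρ⁻¹ * ((1 - u y) * (1 - v z))
  have hk : Measurable (Function.uncurry k) := by
    simp only [k, Function.uncurry_def]
    fun_prop
  have hkq : ∀ y, ∫⁻ z, k y z ∂(q : Measure Y) = 1 := by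
    intro y
    simp only [k]
    rw [lintegral_add_right _ (by fun_prop), lintegral_finsetSum _ (fun j _ => by fun_prop),
      lintegral_const_mul _ (by fun_prop), lintegral_const_mul _ (by fun_prop), hint1v,
      mul_comm _ ρ, ← mul_assoc, ENNReal.inv_mul_cancel hρ0 hρt, one_mul]
    rw [← add_tsub_cancel_of_le (hu1 y)]
    congr 1
    · simp only [u, Finset.mul_sum]
      refine Finset.sum_congr rfl fun j _ => ?_
      rw [lintegral_const_mul _ (by fun_prop), lintegral_const_mul _ (by fun_prop), hb,
        mul_assoc, mul_comm (φ j y), ← mul_assoc (b j)⁻¹, ENNReal.inv_mul_cancel (hb0 j) (hbt j),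
        one_mul]
    · rw [add_tsub_cancel_of_le (hu1 y)]
  have hkp : ∀ z, ∫⁻ y, k y z ∂(p : Measure Y) = 1 := by
    intro z
    simp only [k]
    rw [lintegral_add_right _ (by fun_prop), lintegral_finsetSum _ (fun j _ => by fun_prop),
      lintegral_const_mul _ (by fun_prop), lintegral_mul_const _ (by fun_prop), hint1u,
      ← mul_assoc, ENNReal.inv_mul_cancel hρ0 hρt, one_mul]
    rw [← add_tsub_cancel_of_le (hv1 z)]
    congr 1
    · simp only [v, Finset.mul_sum]
      refine Finset.sum_congr rfl fun j _ => ?_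
      rw [lintegral_const_mul _ (by fun_prop), lintegral_mul_const _ (by fun_prop), ha,
        div_eq_mul_inv]
      ring
    · rw [add_tsub_cancel_of_le (hv1 z)]
  refine (wassersteinDist_le_add_of_density ht hπ hk hkq hkp).trans ?_
  gcongr
  have hpt : ∀ y z, k y z * edist y z ^ t ≤ δ ^ t * k y z + 2 ^ (t - 1) *
      (ρ⁻¹ * ((edist y y₀ ^ t * (1 - u y)) * (1 - v z) +
        (1 - u y) * (edist z y₀ ^ t * (1 - v z)))) := by
    intro y z
    have h1 : (∑ j, θ * (b j)⁻¹ * (φ j y * φ j z)) * edist y z ^ t ≤ δ ^ t * k y z := by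
      refine le_trans ?_ (mul_le_mul_right le_self_add _)
      rw [mul_comm, Finset.mul_sum, Finset.mul_sum]
      refine Finset.sum_le_sum fun j _ => ?_
      by_cases hy : φ j y = 0
      · simp [hy]
      by_cases hz : φ j z = 0
      · simp [hz]
      exact mul_le_mul_left (ENNReal.rpow_le_rpow (hδ j y z hy hz) ht0.le) _
    have h2 : ρ⁻¹ * ((1 - u y) * (1 - v z)) * edist y z ^ t ≤ 2 ^ (t - 1) *
      (ρ⁻¹ * ((edist y y₀ ^ t * (1 - u y)) * (1 - v z) +
        (1 - u y) * (edist z y₀ ^ t * (1 - v z)))) := by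
      refine (mul_le_mul_right (edist_rpow_le ht y z y₀) _).trans_eq ?_
      ring
    simp only [k] at h1 ⊢
    rw [add_mul]
    exact add_le_add h1 h2
  exact lintegral_density_mul_le hk hkq (by fun_prop) (measurable_const.sub hu)
    (measurable_const.sub hv) hρ0 hρt hint1u hint1v hpt

end Partition

end WeakTransport

end

/-! ### The Wasserstein space inside the compact space `P(K) × [0, ∞]`. -/

section

open Filter Topology TopologicalSpace ProbabilityTheory

namespace WeakTransport

universe u

section Compactification

variable {Y K : Type*} [MetricSpace Y] [MeasurableSpace Y] [BorelSpace Y]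
  [TopologicalSpace K] [MeasurableSpace K] [BorelSpace K] {t : ℝ}

/-- The position of `p` in the compactification `P(K) × [0, ∞]` of the Wasserstein space. -/
noncomputable def compactEmbed (t : ℝ) (y₀ : Y) {i : Y → K} (hi : IsEmbedding i)
    (p : ProbabilityMeasure Y) : ProbabilityMeasure K × ℝ≥0∞ :=
  (p.map hi.continuous.measurable.aemeasurable, moment t y₀ p)

theorem lintegral_compactEmbed {t : ℝ} (y₀ : Y) {i : Y → K} (hi : IsEmbedding i)
    (p : ProbabilityMeasure Y) {g : K → ℝ≥0∞} (hg : Measurable g) :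
    ∫⁻ x, g x ∂((compactEmbed t y₀ hi p).1 : Measure K) = ∫⁻ y, g (i y) ∂(p : Measure Y) :=
  lintegral_map hg hi.continuous.measurable

theorem integral_compactEmbed {t : ℝ} (y₀ : Y) {i : Y → K} (hi : IsEmbedding i)
    (p : ProbabilityMeasure Y) (g : C(K, ℝ)) :
    ∫ x, g x ∂((compactEmbed t y₀ hi p).1 : Measure K) = ∫ y, g (i y) ∂(p : Measure Y) :=
  integral_map hi.continuous.measurable.aemeasurable g.continuous.aestronglyMeasurable

/-- Continuous functions on `K` increasing to `d(·, y₀)^t` along `Y`. -/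
theorem exists_continuous_approx_edist {Y K : Type*} [MetricSpace Y] [TopologicalSpace K]
    [MetrizableSpace K] (t : ℝ) (y₀ : Y) {i : Y → K} (hi : IsEmbedding i) :
    ∃ h : ℕ → K → ℝ≥0∞, (∀ n, Continuous (h n)) ∧ Monotone h ∧ (∀ n x, h n x ≤ n) ∧
      (∀ n y, h n (i y) ≤ edist y y₀ ^ t) ∧ ∀ y, ⨆ n, h n (i y) = edist y y₀ ^ t := by
  obtain ⟨h, h1, h2, h3, h4, h5, -⟩ := exists_continuous_approx i fun y : Y => edist y y₀ ^ t
  refine ⟨h, h1, h2, h3, h4, fun y => h5 y fun r hr => ?_⟩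
  have hop : IsOpen {y : Y | r < edist y y₀ ^ t} :=
    isOpen_lt continuous_const ((ENNReal.continuous_rpow_const).comp (by fun_prop))
  obtain ⟨O, hO, hOeq⟩ := hi.isInducing.isOpen_iff.1 hop
  refine ⟨O, hO, ?_, fun y' hy' => ?_⟩
  · have : y ∈ i ⁻¹' O := hOeq ▸ hr
    exact this
  · have : y' ∈ i ⁻¹' O := hy'
    rwa [hOeq] at this

theorem moment_eq_iSup {y₀ : Y} {i : Y → K} (hi : IsEmbedding i) {h : ℕ → K → ℝ≥0∞}
    (hc : ∀ n, Continuous (h n)) (hmono : Monotone h)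
    (hsup : ∀ y, ⨆ n, h n (i y) = edist y y₀ ^ t) (p : ProbabilityMeasure Y) :
    moment t y₀ p = ⨆ n, ∫⁻ y, h n (i y) ∂(p : Measure Y) := by
  have hm : ∀ n, Measurable fun y => h n (i y) :=
    fun n => (hc n).measurable.comp hi.continuous.measurable
  rw [← lintegral_iSup hm fun a b hab y => hmono hab (i y)]
  simp_rw [hsup]
  rfl

end Compactification

/-- A finite family of continuous functions of small support that carries most of the moment. -/
theorem exists_partition {Y : Type u} {K : Type*} [MetricSpace Y] [PolishSpace Y]
    [MeasurableSpace Y] [BorelSpace Y] [TopologicalSpace K] [CompactSpace K] [MetrizableSpace K]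
    [MeasurableSpace K] [BorelSpace K] {t : ℝ} (y₀ : Y) {i : Y → K} (hi : IsEmbedding i)
    {p : ProbabilityMeasure Y} (hp : moment t y₀ p < ∞) {δ ε : ℝ≥0∞} (hδ : 0 < δ) (hε : 0 < ε) :
    ∃ (ι : Type u) (_ : Fintype ι) (φ : ι → K → ℝ≥0∞) (g : K → ℝ≥0∞),
      (∀ j, Continuous (φ j)) ∧ (∀ x, ∑ j, φ j x ≤ 1) ∧
      (∀ j y z, φ j (i y) ≠ 0 → φ j (i z) ≠ 0 → edist y z ≤ δ) ∧
      (∀ j, ∫⁻ y, φ j (i y) ∂(p : Measure Y) ≠ 0) ∧ Continuous g ∧ (∃ N : ℕ, ∀ x, g x ≤ N) ∧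
      (∀ y, g (i y) ≤ edist y y₀ ^ t) ∧
      moment t y₀ p < (∫⁻ y, g (i y) * ∑ j, φ j (i y) ∂(p : Measure Y)) + ε := by
  obtain ⟨h, hc, hmono, hN, hle, hsup⟩ := exists_continuous_approx_edist t y₀ hi
  obtain ⟨n, hn⟩ : ∃ n, moment t y₀ p < (∫⁻ y, h n (i y) ∂(p : Measure Y)) + ε / 2 := by
    rcases eq_or_ne (moment t y₀ p) 0 with h0 | h0
    · exact ⟨0, by rw [h0]; exact (ENNReal.half_pos hε.ne').trans_le le_add_self⟩
    have hlt : moment t y₀ p - ε / 2 < ⨆ n, ∫⁻ y, h n (i y) ∂(p : Measure Y) := by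
      rw [← moment_eq_iSup hi hc hmono hsup p]
      exact ENNReal.sub_lt_self hp.ne h0 (ENNReal.half_pos hε.ne').ne'
    obtain ⟨n, hn⟩ := lt_iSup_iff.1 hlt
    refine ⟨n, ?_⟩
    rcases eq_or_ne (ε / 2) ∞ with h2 | h2
    · rw [h2, add_top]; exact hp
    · exact lt_of_le_of_lt le_tsub_add (ENNReal.add_lt_add_right h2 hn)
  -- As `h n ≤ n`, the part of its integral lying outside `L` is at most `ε / 2`.
  obtain ⟨L, hL, hLp⟩ : ∃ L : Set Y, IsCompact L ∧ n * (p : Measure Y) Lᶜ ≤ ε / 2 := by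
    obtain ⟨L, hL, hLp⟩ := isTightMeasureSet_iff_exists_isCompact_measure_compl_le.1
      (isTightMeasureSet_singleton (μ := (p : Measure Y))) (ε / 2 / n)
      (ENNReal.div_pos (ENNReal.half_pos hε.ne').ne' (ENNReal.natCast_ne_top n))
    refine ⟨L, hL, (mul_le_mul_right (hLp _ rfl) _).trans ENNReal.mul_div_le⟩
  choose V hV hVi using fun c : Y => hi.isInducing.isOpen_iff.1
    (Metric.isOpen_eball (x := c) (ε := δ / 2))
  obtain ⟨T, hT⟩ := (hL.image hi.continuous).elim_finite_subcover V hV (by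
    rintro _ ⟨y, -, rfl⟩
    refine mem_iUnion.2 ⟨y, ?_⟩
    have : y ∈ i ⁻¹' V y := by
      rw [hVi]; exact Metric.mem_eball_self (ENNReal.half_pos hδ.ne')
    exact this)
  obtain ⟨f, hf⟩ := PartitionOfUnity.exists_isSubordinate (hL.image hi.continuous).isClosed
    (fun c : T => V c) (fun c => hV c) (by simpa [iUnion_subtype] using hT)
  have hsum : ∀ x, ∑ c, ENNReal.ofReal (f c x) = ENNReal.ofReal (∑ᶠ c, f c x) := fun x => by
    rw [finsum_eq_sum_of_fintype, ENNReal.ofReal_sum_of_nonneg fun c _ => f.nonneg c x]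
  let φ : T → K → ℝ≥0∞ := fun c x => ENNReal.ofReal (f c x)
  have hφ : ∀ c, Continuous (φ c) := fun c => ENNReal.continuous_ofReal.comp (f c).continuous
  have hφm : ∀ c, Measurable fun y => φ c (i y) :=
    fun c => (hφ c).measurable.comp hi.continuous.measurable
  have hφ1 : ∀ x, ∑ c, φ c x ≤ 1 := fun x => by
    simp only [φ]
    rw [hsum]
    exact ENNReal.ofReal_le_one.2 (f.sum_le_one x)
  have hφV : ∀ c y, φ c (i y) ≠ 0 → edist y c ≤ δ / 2 := by
    intro c y hy
    have h1 : f c (i y) ≠ 0 := fun h0 => hy (by simp [φ, h0])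
    have h2 : y ∈ i ⁻¹' V c := hf c (subset_tsupport _ h1)
    rw [hVi] at h2
    exact (Metric.mem_eball.1 h2).le
  -- Cells of zero mass are discarded: the cell masses must be nonzero for `θ * a j < a j` to hold.
  let Q : T → Prop := fun c => ∫⁻ y, φ c (i y) ∂(p : Measure Y) ≠ 0
  have hae : ∀ᵐ y ∂(p : Measure Y), ∑ c : {c // Q c}, φ c (i y) = ∑ c, φ c (i y) := by
    have h0 : ∀ c : {c // ¬ Q c}, ∀ᵐ y ∂(p : Measure Y), φ c (i y) = 0 := fun c =>
      (lintegral_eq_zero_iff (hφm c)).1 (not_not.1 c.2)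
    filter_upwards [ae_all_iff.2 h0] with y hy
    rw [← Fintype.sum_subtype_add_sum_subtype Q fun c => φ c (i y),
      Finset.sum_eq_zero (s := (Finset.univ : Finset {c // ¬ Q c})) fun c _ => hy c, add_zero]
  refine ⟨{c // Q c}, inferInstance, fun c => φ c, h n, fun c => hφ c, fun x => ?_,
    fun c y z hy hz => ?_, fun c => c.2, hc n, ⟨n, hN n⟩, hle n, hn.trans_le ?_⟩
  · refine le_trans ?_ (hφ1 x)
    rw [← Fintype.sum_subtype_add_sum_subtype Q fun c => φ c x]
    exact le_self_add
  · refine (edist_triangle_right y z (c : T)).trans ((add_le_add (hφV _ _ hy) (hφV _ _ hz)).trans ?_)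
    rw [ENNReal.add_halves]
  · conv_rhs => rw [← ENNReal.add_halves ε, ← add_assoc]
    refine add_le_add ?_ le_rfl
    refine le_trans ?_ (add_le_add le_rfl hLp)
    rw [lintegral_congr_ae (hae.mono fun y hy => congrArg (h n (i y) * ·) hy)]
    have hm : Measurable fun y => h n (i y) * ∑ c, φ c (i y) :=
      ((hc n).measurable.comp hi.continuous.measurable).mul
        (Finset.measurable_fun_sum _ fun c _ => hφm c)
    rw [← lintegral_indicator_const hL.measurableSet.compl, ← lintegral_add_left hm]
    refine lintegral_mono fun y => ?_
    by_cases hy : y ∈ L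
    · have : ∑ c, φ c (i y) = 1 := by
        simp only [φ]
        rw [hsum, f.sum_eq_one (mem_image_of_mem i hy), ENNReal.ofReal_one]
      rw [this, mul_one]
      exact le_self_add
    · rw [indicator_of_mem (by exact hy)]
      exact (hN n _).trans le_add_self

section Topology

variable {Y K : Type*} [MetricSpace Y] [PolishSpace Y] [MeasurableSpace Y] [BorelSpace Y]
  [TopologicalSpace K] [CompactSpace K] [MetrizableSpace K] [MeasurableSpace K] [BorelSpace K]
  {t : ℝ}

theorem continuous_compactEmbed_lintegral {K : Type*} [TopologicalSpace K] [CompactSpace K]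
    [MeasurableSpace K] [BorelSpace K] {g : K → ℝ≥0∞} (hg : Continuous g) {N : ℕ}
    (hN : ∀ x, g x ≤ N) :
    Continuous fun z : ProbabilityMeasure K × ℝ≥0∞ => ∫⁻ x, g x ∂(z.1 : Measure K) :=
  (ProbabilityMeasure.continuous_lintegral_of_ne_top hg
    fun x => ((hN x).trans_lt (ENNReal.natCast_lt_top N)).ne).comp continuous_fst

/-- The Wasserstein topology is coarser than the one induced by the compactification. -/
theorem exists_isOpen_wassersteinDist_lt (ht : 1 ≤ t) (y₀ : Y) {i : Y → K} (hi : IsEmbedding i)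
    {p₀ : ProbabilityMeasure Y} {p : ProbabilityMeasure Y} (hp : moment t y₀ p < ∞) {r : ℝ≥0∞}
    (hr : wassersteinDist t p₀ p < r) :
    ∃ O : Set (ProbabilityMeasure K × ℝ≥0∞), IsOpen O ∧ compactEmbed t y₀ hi p ∈ O ∧
      ∀ q, compactEmbed t y₀ hi q ∈ O → wassersteinDist t p₀ q < r := by
  have ht0 : 0 < t := by linarith
  obtain ⟨s, hs, hsr⟩ := exists_between hr
  obtain ⟨π, hπ, hπs⟩ : ∃ π ∈ couplings p₀ p,
      (∫⁻ z, edist z.1 z.2 ^ t ∂(π : Measure (Y × Y))) ^ (1 / t) < s := by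
    rw [wassersteinDist, one_div, ENNReal.rpow_inv_lt_iff ht0] at hs
    simp only [iInf_lt_iff] at hs
    obtain ⟨π, hπ, h⟩ := hs
    exact ⟨π, hπ, by rwa [one_div, ENNReal.rpow_inv_lt_iff ht0]⟩
  -- Room left for the second step of the triangle inequality. Its `t`-th power is split in halves,
  -- one for the diameter of the cells and one for the uncoupled remainders.
  obtain ⟨e, he, het, hse⟩ : ∃ e : ℝ≥0∞, 0 < e ∧ e < ∞ ∧ s + e ≤ r := by
    obtain ⟨r', hsr', hr'⟩ := exists_between hsr
    exact ⟨r' - s, tsub_pos_of_lt hsr', tsub_le_self.trans_lt hr'.lt_top,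
      (add_tsub_cancel_of_le hsr'.le).le.trans hr'.le⟩
  have hE : 0 < e ^ t / 2 := ENNReal.half_pos (ENNReal.rpow_pos_of_nonneg he ht0.le).ne'
  obtain ⟨δ, hδ, hδe⟩ : ∃ δ : ℝ≥0∞, 0 < δ ∧ δ ^ t ≤ e ^ t / 2 :=
    ⟨(e ^ t / 2) ^ t⁻¹, ENNReal.rpow_pos_of_nonneg hE (by positivity),
      by rw [ENNReal.rpow_inv_rpow ht0.ne']⟩
  obtain ⟨ε, hε, hεe⟩ : ∃ ε : ℝ≥0∞, 0 < ε ∧ 2 ^ (t - 1) * (ε + ε) ≤ e ^ t / 2 := by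
    refine ⟨e ^ t / 2 / 2 ^ (t - 1) / 2,
      ENNReal.half_pos (ENNReal.div_pos hE.ne' (two_rpow_ne_top _)).ne', ?_⟩
    rw [ENNReal.add_halves]
    exact ENNReal.mul_div_le
  obtain ⟨ι, _, φ, g, hφc, hφ1, hφδ, hφ0, hg, ⟨N, hN⟩, hgle, hmom⟩ :=
    exists_partition (t := t) y₀ hi hp hδ hε
  have hφm : ∀ j, Measurable fun y => φ j (i y) :=
    fun j => (hφc j).measurable.comp hi.continuous.measurable
  have hgm : Measurable fun y => g (i y) := hg.measurable.comp hi.continuous.measurable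
  let G : K → ℝ≥0∞ := fun x => g x * ∑ j, φ j x
  have hGc : Continuous G := by
    have hφN : ∀ x, ∑ j, φ j x ≠ ∞ := fun x => ((hφ1 x).trans_lt ENNReal.one_lt_top).ne
    refine continuous_iff_continuousAt.2 fun x => ENNReal.Tendsto.mul hg.continuousAt
      (Or.inr (hφN x)) (continuous_finsetSum _ fun j _ => hφc j).continuousAt
      (Or.inr ((hN x).trans_lt (ENNReal.natCast_lt_top N)).ne)
  have hGm : Measurable fun y => G (i y) := hGc.measurable.comp hi.continuous.measurable
  have hGN : ∀ x, G x ≤ N := fun x => (mul_le_mul' (hN x) (hφ1 x)).trans (by simp)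
  have hφN : ∀ j x, φ j x ≤ (1 : ℕ) := fun j x => by
    rw [Nat.cast_one]
    exact (Finset.single_le_sum (f := fun j => φ j x) (fun _ _ => zero_le)
      (Finset.mem_univ j)).trans (hφ1 x)
  set a : ι → ℝ≥0∞ := fun j => ∫⁻ y, φ j (i y) ∂(p : Measure Y) with ha
  have hat : ∀ j, a j ≠ ∞ := fun j =>
    ((lintegral_mono fun y => hφN j (i y)).trans_lt (by simp)).ne
  set A : ℝ≥0∞ := ∫⁻ y, G (i y) ∂(p : Measure Y) with hA
  have hAt : A ≠ ∞ := ((lintegral_mono fun y => hGN (i y)).trans_lt (by simp)).ne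
  -- The square appears because the remainder of `q` involves `θ * (a j / b j)`, and the ratio
  -- itself is only known to be at least `θ`.
  obtain ⟨θ, hθ1, hθm⟩ : ∃ θ : ℝ≥0∞, θ < 1 ∧ moment t y₀ p < θ * θ * A + ε := by
    have hcont : Tendsto (fun θ : ℝ≥0∞ => θ * θ * A + ε) (𝓝[<] 1) (𝓝 (1 * 1 * A + ε)) := by
      refine Tendsto.mono_left ?_ nhdsWithin_le_nhds
      refine Tendsto.add (ENNReal.Tendsto.mul_const (ENNReal.Tendsto.mul tendsto_id (by simp)
        tendsto_id (by simp)) (Or.inr hAt)) tendsto_const_nhds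
    rw [one_mul, one_mul] at hcont
    have := ((hcont.eventually_const_lt hmom).and self_mem_nhdsWithin).exists
    obtain ⟨θ, h1, h2⟩ := this
    exact ⟨θ, h2, h1⟩
  have hθt : θ ≠ ∞ := hθ1.ne_top
  -- Cell masses are kept close in both directions, whereas the moment is only bounded from above:
  -- at most `ε` of it may escape what the cells carry.
  let O : Set (ProbabilityMeasure K × ℝ≥0∞) :=
    {z | (∀ j, θ * a j < ∫⁻ x, φ j x ∂(z.1 : Measure K)) ∧
      (∀ j, θ * ∫⁻ x, φ j x ∂(z.1 : Measure K) < a j) ∧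
      z.2 < θ * θ * (∫⁻ x, G x ∂(z.1 : Measure K)) + ε}
  have hO : IsOpen O := by
    refine IsOpen.and ?_ (IsOpen.and ?_ ?_)
    · simp only [ofPred_forall]
      exact isOpen_iInter_of_finite fun j => isOpen_lt continuous_const
        (continuous_compactEmbed_lintegral (hφc j) (hφN j))
    · simp only [ofPred_forall]
      exact isOpen_iInter_of_finite fun j => isOpen_lt ((ENNReal.continuous_const_mul hθt).comp
        (continuous_compactEmbed_lintegral (hφc j) (hφN j))) continuous_const
    · refine isOpen_lt continuous_snd (Continuous.add ((ENNReal.continuous_const_mul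
        (ENNReal.mul_ne_top hθt hθt)).comp (continuous_compactEmbed_lintegral hGc hGN))
        continuous_const)
  have hmem : ∀ q, compactEmbed t y₀ hi q ∈ O ↔
      (∀ j, θ * a j < ∫⁻ y, φ j (i y) ∂(q : Measure Y)) ∧
      (∀ j, θ * ∫⁻ y, φ j (i y) ∂(q : Measure Y) < a j) ∧
      moment t y₀ q < θ * θ * (∫⁻ y, G (i y) ∂(q : Measure Y)) + ε := by
    intro q
    rw [← lintegral_compactEmbed (t := t) y₀ hi q hGc.measurable]
    simp_rw [← fun j => lintegral_compactEmbed (t := t) y₀ hi q (hφc j).measurable]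
    rfl
  have hmul : ∀ j, θ * a j < a j := fun j => by
    conv_rhs => rw [← one_mul (a j)]
    exact ENNReal.mul_lt_mul_left (hφ0 j) (hat j) hθ1
  -- the part of the moment that is not transported within the partition is small
  have hrest : ∀ (q : ProbabilityMeasure Y) (w : Y → ℝ≥0∞), Measurable w → (∀ y, w y ≤ 1) →
      (∀ y, θ * θ * ∑ j, φ j (i y) ≤ w y) →
      moment t y₀ q < θ * θ * (∫⁻ y, G (i y) ∂(q : Measure Y)) + ε →
      ∫⁻ y, edist y y₀ ^ t * (1 - w y) ∂(q : Measure Y) ≤ ε := by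
    intro q w hw hw1 hwθ hq
    have hfin : θ * θ * (∫⁻ y, G (i y) ∂(q : Measure Y)) ≠ ∞ :=
      ENNReal.mul_ne_top (ENNReal.mul_ne_top hθt hθt)
        ((lintegral_mono fun y => hGN (i y)).trans_lt (by simp)).ne
    have h1 : (∫⁻ y, edist y y₀ ^ t * (1 - w y) ∂(q : Measure Y)) +
        θ * θ * (∫⁻ y, G (i y) ∂(q : Measure Y)) ≤ moment t y₀ q := by
      rw [← lintegral_const_mul _ hGm, ← lintegral_add_left (by fun_prop)]
      refine lintegral_mono fun y => ?_
      have h2 : θ * θ * G (i y) ≤ edist y y₀ ^ t * w y := by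
        simp only [G]
        rw [mul_left_comm]
        exact mul_le_mul' (hgle y) (hwθ y)
      refine (add_le_add_right h2 _).trans_eq ?_
      rw [← mul_add, tsub_add_cancel_of_le (hw1 y), mul_one]
    have h3 := (h1.trans_lt hq).le
    rw [add_comm] at h3
    exact (ENNReal.add_le_add_iff_left hfin).1 h3
  have hθθ : θ * θ ≤ θ := mul_le_of_le_one_left' hθ1.le
  refine ⟨O, hO, (hmem p).2 ⟨hmul, hmul, hθm⟩, fun q hq => ?_⟩
  obtain ⟨hq1, hq2, hq3⟩ := (hmem q).1 hq
  set b : ι → ℝ≥0∞ := fun j => ∫⁻ y, φ j (i y) ∂(q : Measure Y) with hb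
  have hb0 : ∀ j, b j ≠ 0 := fun j => (zero_le.trans_lt (hq1 j)).ne'
  have hbt : ∀ j, b j ≠ ∞ := fun j =>
    ((lintegral_mono fun y => hφN j (i y)).trans_lt (by simp)).ne
  have hW := wassersteinDist_le_add_of_partition ht hπ hφm (fun y => hφ1 (i y)) hφδ hθ1
    (fun j => rfl) (fun j => rfl) hb0 (fun j => (hq1 j).le) y₀
  refine hW.trans_lt (lt_of_lt_of_le ?_ hse)
  have hlast : (δ ^ t + 2 ^ (t - 1) *
        ((∫⁻ y, edist y y₀ ^ t * (1 - θ * ∑ j, φ j (i y)) ∂(p : Measure Y)) +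
          ∫⁻ z, edist z y₀ ^ t * (1 - θ * ∑ j, a j / b j * φ j (i z)) ∂(q : Measure Y))) ^ (1 / t)
      ≤ e := by
    rw [one_div, ENNReal.rpow_inv_le_iff ht0]
    refine (add_le_add hδe ((mul_le_mul_right (add_le_add ?_ ?_) _).trans hεe)).trans_eq
      (ENNReal.add_halves _)
    · refine hrest p _ (Measurable.const_mul (Finset.measurable_fun_sum _ fun j _ => hφm j) _) (fun y => ?_) (fun y => ?_) hθm
      · exact (mul_le_mul' hθ1.le (hφ1 _)).trans (by simp)
      · gcongr
    · refine hrest q _ (Measurable.const_mul (Finset.measurable_fun_sum _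
        fun j _ => (hφm j).const_mul _) _) (fun y => ?_) (fun y => ?_) hq3
      · refine le_trans ?_ (hφ1 (i y))
        rw [Finset.mul_sum]
        refine Finset.sum_le_sum fun j _ => ?_
        rw [← mul_assoc, ← mul_div_assoc]
        exact mul_le_of_le_one_left' (ENNReal.div_le_of_le_mul (by simpa using (hq1 j).le))
      · rw [mul_assoc]
        refine mul_le_mul_right ?_ θ
        rw [Finset.mul_sum]
        refine Finset.sum_le_sum fun j _ => mul_le_mul_left ?_ _
        rw [ENNReal.le_div_iff_mul_le (Or.inl (hb0 j)) (Or.inl (hbt j))]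
        exact (hq2 j).le
  exact ENNReal.add_lt_add_of_lt_of_le (hlast.trans_lt het).ne hπs hlast

end Topology

end WeakTransport

end

/-! ### Lower semicontinuous costs on the compactification, and measurability. -/

section

open Filter Topology TopologicalSpace ProbabilityTheory

namespace WeakTransport

theorem toENNReal_sub_le_iff {a : EReal} {c : ℝ} {r : ℝ≥0∞} :
    (a - c).toENNReal ≤ r ↔ a ≤ (r : EReal) + c := by
  rw [← EReal.sub_le_iff_le_add (by simp) (by simp)]
  generalize a - (c : EReal) = x
  rcases le_total x 0 with hx | hx
  · simp only [EReal.toENNReal_of_nonpos hx, zero_le, true_iff]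
    exact hx.trans (EReal.coe_ennreal_nonneg r)
  · rw [← EReal.coe_ennreal_le_coe_ennreal_iff, EReal.coe_toENNReal hx]

theorem coe_toENNReal_sub_add {a : EReal} {c : ℝ} (h : (c : EReal) ≤ a) :
    ((a - c).toENNReal : EReal) + c = a := by
  rw [EReal.coe_toENNReal (by rwa [EReal.sub_nonneg (by simp) (by simp)]), EReal.sub_add_cancel]

section Cost

variable {X Y H K : Type*} [MetricSpace Y] [MeasurableSpace Y] {t : ℝ}

/-- The cost, shifted by a lower bound `c`, as a nonnegative function on `X × P(Y)`. -/
noncomputable def shiftCost (C : X × WassersteinSpace Y t → EReal) (c : ℝ)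
    (z : X × ProbabilityMeasure Y) : ℝ≥0∞ :=
  (extendCost C z - c).toENNReal

theorem extendCost_toProb (C : X × WassersteinSpace Y t → EReal) (x : X)
    (p : WassersteinSpace Y t) : extendCost C (x, p.toProb) = C (x, p) := by
  rw [extendCost, dif_pos p.finite_moment]

theorem extendCost_of_not_hasFiniteMoment (C : X × WassersteinSpace Y t → EReal) (x : X)
    {p : ProbabilityMeasure Y} (hp : ¬ HasFiniteMoment t p) : extendCost C (x, p) = ⊤ := by
  rw [extendCost, dif_neg hp]

theorem le_extendCost {C : X × WassersteinSpace Y t → EReal} {c : ℝ}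
    (hc : ∀ z, (c : EReal) ≤ C z) (z : X × ProbabilityMeasure Y) :
    (c : EReal) ≤ extendCost C z := by
  rw [extendCost]
  split_ifs
  · exact hc _
  · exact le_top

theorem coe_shiftCost_add {C : X × WassersteinSpace Y t → EReal} {c : ℝ}
    (hc : ∀ z, (c : EReal) ≤ C z) (z : X × ProbabilityMeasure Y) :
    (shiftCost C c z : EReal) + c = extendCost C z :=
  coe_toENNReal_sub_add (le_extendCost hc z)

variable [BorelSpace Y] [TopologicalSpace K] [MeasurableSpace K] [BorelSpace K]

/-- The embedding of `X × P(Y)` into `H × P(K) × [0, ∞]`. -/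
noncomputable def pairEmbed (t : ℝ) (y₀ : Y) (iX : X → H) {i : Y → K} (hi : IsEmbedding i)
    (z : X × ProbabilityMeasure Y) : H × (ProbabilityMeasure K × ℝ≥0∞) :=
  (iX z.1, compactEmbed t y₀ hi z.2)

variable [PolishSpace Y] [TopologicalSpace X] [TopologicalSpace H] [CompactSpace K]
  [MetrizableSpace K]

/-- Superlevel sets of the cost are open in the product topology, and the topology induced by the
embedding is at least as fine, so they contain traces of open sets of the compactification. -/
theorem exists_isOpen_lt_cost (ht : 1 ≤ t) (y₀ : Y) {iX : X → H} (hX : IsInducing iX) {i : Y → K}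
    (hi : IsEmbedding i) {C : X × WassersteinSpace Y t → EReal} (hC : LowerSemicontinuous C)
    {z : X × WassersteinSpace Y t} {r : EReal} (hr : r < C z) :
    ∃ O, IsOpen O ∧ pairEmbed t y₀ iX hi (z.1, z.2.toProb) ∈ O ∧
      ∀ z' : X × WassersteinSpace Y t, pairEmbed t y₀ iX hi (z'.1, z'.2.toProb) ∈ O → r < C z' := by
  let f : WassersteinSpace Y t → ProbabilityMeasure K × ℝ≥0∞ :=
    fun p => compactEmbed t y₀ hi p.toProb
  have hle : induced f inferInstance ≤ (inferInstance : TopologicalSpace (WassersteinSpace Y t)) := by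
    refine le_generateFrom ?_
    rintro s ⟨p₀, ρ, rfl⟩
    rw [@isOpen_iff_forall_mem_open _ (induced f inferInstance)]
    intro p hp
    obtain ⟨O, hO, hpO, h⟩ := exists_isOpen_wassersteinDist_lt ht y₀ hi
      (moment_lt_top_of_hasFiniteMoment ht p.finite_moment y₀) hp
    exact ⟨f ⁻¹' O, fun q hq => h _ hq, ⟨O, hO, rfl⟩, hpO⟩
  have hnhds : comap (fun z' : X × WassersteinSpace Y t => (iX z'.1, f z'.2)) (𝓝 (iX z.1, f z.2)) ≤
      𝓝 z := by
    have h1 : comap f (𝓝 (f z.2)) ≤ 𝓝 z.2 := by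
      rw [← nhds_induced]
      exact nhds_mono hle
    rw [nhds_prod_eq (x := iX z.1), ← Prod.mk.eta (p := z), nhds_prod_eq (x := z.1),
      hX.nhds_eq_comap]
    refine le_trans ?_ (prod_mono_right _ h1)
    rw [prod_comap_comap_eq]
  obtain ⟨V, hV, hVs⟩ := mem_comap.1 (hnhds (hC z r hr))
  obtain ⟨O, hOV, hO, hzO⟩ := mem_nhds_iff.1 hV
  exact ⟨O, hO, hzO, fun z' hz' => hVs (hOV hz')⟩

/-- The approximants live on the whole compactification. Since they increase to `∞` off the closure
of the image, a measure under which the limit has finite integral is carried by that closure. -/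
theorem exists_continuous_approx_cost [MetrizableSpace H] (ht : 1 ≤ t) (y₀ : Y) {iX : X → H}
    (hX : IsInducing iX) {i : Y → K} (hi : IsEmbedding i) {C : X × WassersteinSpace Y t → EReal}
    (hC : LowerSemicontinuous C) (c : ℝ) :
    ∃ h : ℕ → H × (ProbabilityMeasure K × ℝ≥0∞) → ℝ≥0∞, (∀ n, Continuous (h n)) ∧ Monotone h ∧
      (∀ n x, h n x ≤ n) ∧
      (∀ x p, HasFiniteMoment t p → ⨆ n, h n (pairEmbed t y₀ iX hi (x, p)) = shiftCost C c (x, p)) ∧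
      ∀ w ∉ closure (range fun z : X × WassersteinSpace Y t =>
        pairEmbed t y₀ iX hi (z.1, z.2.toProb)), ⨆ n, h n w = ∞ := by
  obtain ⟨h, h1, h2, h3, h4, h5, h6⟩ := exists_continuous_approx
    (fun z : X × WassersteinSpace Y t => pairEmbed t y₀ iX hi (z.1, z.2.toProb))
    (fun z => (C z - c).toENNReal)
  refine ⟨h, h1, h2, h3, fun x p hp => ?_, h6⟩
  have := h5 (x, ⟨p, hp⟩) fun r hr => ?_
  · rw [this, shiftCost, ← extendCost_toProb C]
  · obtain ⟨O, hO, hzO, h⟩ := exists_isOpen_lt_cost ht y₀ hX hi hC (z := (x, ⟨p, hp⟩))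
      (r := (r : EReal) + c) (not_le.1 fun hle => absurd hr (not_lt.2 (toENNReal_sub_le_iff.2 hle)))
    exact ⟨O, hO, hzO, fun z' hz' =>
      not_le.1 fun hle => absurd (h z' hz') (not_lt.2 (toENNReal_sub_le_iff.1 hle))⟩

end Cost

theorem measurable_moment {Y : Type*} [MetricSpace Y]
    [MeasurableSpace Y] [BorelSpace Y] (t : ℝ) (y₀ : Y) :
    Measurable fun p : ProbabilityMeasure Y => moment t y₀ p :=
  ProbabilityMeasure.measurable_lintegral (by fun_prop)

section Measurability

variable {X Y H K : Type*} [TopologicalSpace X] [PolishSpace X] [MeasurableSpace X] [BorelSpace X]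
  [MetricSpace Y] [PolishSpace Y] [MeasurableSpace Y] [BorelSpace Y]
  [TopologicalSpace H] [MetrizableSpace H] [CompactSpace H] [MeasurableSpace H] [BorelSpace H]
  [TopologicalSpace K] [CompactSpace K] [MetrizableSpace K] [MeasurableSpace K] [BorelSpace K]
  {t : ℝ}

/-- By Lusin–Souslin, an injective measurable map out of a standard Borel space suffices.
Topologically the map need not be an embedding for weak convergence, because the moment is only
semicontinuous. -/
theorem measurableEmbedding_pairEmbed (t : ℝ) (y₀ : Y) {iX : X → H} (hX : IsEmbedding iX)
    {i : Y → K} (hi : IsEmbedding i) : MeasurableEmbedding (pairEmbed t y₀ iX hi) := by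
  have : Nonempty Y := ⟨y₀⟩
  have := ProbabilityMeasure.standardBorelSpace (Y := Y)
  have hi' := hi.continuous.measurableEmbedding hi.injective
  have hm : Measurable (pairEmbed t y₀ iX hi) :=
    (hX.continuous.measurable.comp measurable_fst).prodMk
      (((ProbabilityMeasure.measurable_map hi'.measurable).comp measurable_snd).prodMk
        ((measurable_moment t y₀).comp measurable_snd))
  refine hm.measurableEmbedding ?_
  rintro ⟨x, p⟩ ⟨x', p'⟩ h
  have h1 : iX x = iX x' := congrArg Prod.fst h
  have h2 : p.map hi'.measurable.aemeasurable = p'.map hi'.measurable.aemeasurable :=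
    congrArg (fun z => z.2.1) h
  rw [hX.injective h1, (ProbabilityMeasure.measurableEmbedding_map hi').injective h2]

/-- Although `W_t` and weak convergence give different topologies, on laws of finite moment the cost
is a countable supremum of continuous functions of the measurable map `pairEmbed`. -/
theorem measurable_shiftCost (ht : 1 ≤ t) {C : X × WassersteinSpace Y t → EReal}
    (hC : LowerSemicontinuous C) (c : ℝ) : Measurable (shiftCost C c) := by
  classical
  rcases isEmpty_or_nonempty Y with hY | ⟨⟨y₀⟩⟩
  · have : IsEmpty (X × ProbabilityMeasure Y) := ⟨fun z => hY.elim z.2.nonempty.some⟩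
    exact measurable_of_empty _
  let _ := upgradeIsCompletelyMetrizable X
  obtain ⟨iX, hX⟩ := Metric.PiNatEmbed.exists_embedding_to_hilbert_cube (X := X)
  obtain ⟨i, hi⟩ := Metric.PiNatEmbed.exists_embedding_to_hilbert_cube (X := Y)
  obtain ⟨h, h1, -, -, h4, -⟩ := exists_continuous_approx_cost ht y₀ hX.isInducing hi hC c
  have heq : shiftCost C c = fun z => if moment t y₀ z.2 < ∞ then
      ⨆ n, h n (pairEmbed t y₀ iX hi z) else ∞ := by
    ext ⟨x, p⟩
    split_ifs with hp
    · exact (h4 x p ((hasFiniteMoment_iff ht y₀ p).2 hp)).symm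
    · rw [shiftCost, extendCost_of_not_hasFiniteMoment C x
        (fun h => hp ((hasFiniteMoment_iff ht y₀ p).1 h))]
      simp
  rw [heq]
  refine Measurable.ite (measurableSet_lt ((measurable_moment t y₀).comp measurable_snd)
    measurable_const) ?_ measurable_const
  exact .iSup fun n => (h1 n).measurable.comp (measurableEmbedding_pairEmbed t y₀ hX hi).measurable

theorem measurable_extendCost (ht : 1 ≤ t) {C : X × WassersteinSpace Y t → EReal}
    (hC : ConditionA C) : Measurable (extendCost C) := by
  obtain ⟨c, hc⟩ := hC.bddBelow
  have : extendCost C = fun z => (shiftCost C c z : EReal) + c := by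
    ext z
    exact (coe_shiftCost_add hc z).symm
  rw [this]
  exact (measurable_shiftCost ht hC.lsc c).coe_ereal_ennreal.add_const _

end Measurability

end WeakTransport

end

/-! ### Intensities, and the alternative on the compact product. -/

section

open Filter Topology TopologicalSpace ProbabilityTheory

namespace MeasureTheory.ProbabilityMeasure

variable {Y : Type*} [MeasurableSpace Y]

theorem integral_evalKernel_comp (Q : Measure (ProbabilityMeasure Y)) [SFinite Q] {f : Y → ℝ}
    (hf : Integrable f (Q.bind (evalKernel Y))) :
    ∫ y, f y ∂(Q.bind (evalKernel Y)) = ∫ p, ∫ y, f y ∂(p : Measure Y) ∂Q := by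
  rw [← Measure.snd_compProd, Measure.snd] at hf ⊢
  have hf' : Integrable (fun z : ProbabilityMeasure Y × Y => f z.2) (Q ⊗ₘ evalKernel Y) :=
    hf.comp_measurable measurable_snd
  rw [integral_map measurable_snd.aemeasurable hf.1, Measure.integral_compProd hf']
  rfl

theorem bind_evalKernel_apply (Q : Measure (ProbabilityMeasure Y)) {s : Set Y}
    (hs : MeasurableSet s) : Q.bind (evalKernel Y) s = ∫⁻ p, (p : Measure Y) s ∂Q :=
  Measure.bind_apply hs (evalKernel Y).measurable.aemeasurable

theorem bind_evalKernel_eq_iff [TopologicalSpace Y] [PseudoMetrizableSpace Y] [BorelSpace Y]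
    (Q : Measure (ProbabilityMeasure Y)) [IsProbabilityMeasure Q] (ν : ProbabilityMeasure Y) :
    Q.bind (evalKernel Y) = ν ↔
      ∀ f : Y →ᵇ ℝ, ∫ p, ∫ y, f y ∂(p : Measure Y) ∂Q = ∫ y, f y ∂(ν : Measure Y) := by
  have h : ∀ f : Y →ᵇ ℝ, ∫ p, ∫ y, f y ∂(p : Measure Y) ∂Q = ∫ y, f y ∂(Q.bind (evalKernel Y)) :=
    fun f => (integral_evalKernel_comp Q (f.integrable _)).symm
  simp_rw [h]
  refine ⟨fun h f => by rw [h], fun h => ext_of_forall_integral_eq_of_IsFiniteMeasure h⟩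

theorem ae_apply_eq_one_of_bind {Q : Measure (ProbabilityMeasure Y)} {s : Set Y}
    (hs : MeasurableSet s) (h : Q.bind (evalKernel Y) sᶜ = 0) :
    ∀ᵐ p ∂Q, ((p : ProbabilityMeasure Y) : Measure Y) s = 1 := by
  rw [bind_evalKernel_apply Q hs.compl, lintegral_eq_zero_iff (measurable_apply hs.compl)] at h
  filter_upwards [h] with p hp
  exact (prob_compl_eq_zero_iff hs).1 hp

end MeasureTheory.ProbabilityMeasure

open MeasureTheory.ProbabilityMeasure (evalKernel)

namespace WeakTransport

/-- Bounded continuous functions determine a finite measure, so the intensity condition becomes an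
equality of measures, usable with unbounded nonnegative integrands. -/
theorem mem_liftedCouplings_iff {X Y : Type*} [MeasurableSpace X] [MetricSpace Y]
    [MeasurableSpace Y] [BorelSpace Y] {μ : ProbabilityMeasure X} {ν : ProbabilityMeasure Y}
    {P : ProbabilityMeasure (X × ProbabilityMeasure Y)} :
    P ∈ liftedCouplings μ ν ↔
      (P : Measure (X × ProbabilityMeasure Y)).map Prod.fst = (μ : Measure X) ∧
      ((P : Measure (X × ProbabilityMeasure Y)).map Prod.snd).bind (evalKernel Y) = ν := by
  have := Measure.isProbabilityMeasure_map (μ := (P : Measure (X × ProbabilityMeasure Y)))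
    measurable_snd.aemeasurable
  rw [ProbabilityMeasure.bind_evalKernel_eq_iff]
  rfl

section Farkas

variable {E H K : Type*} [TopologicalSpace H] [CompactSpace H]
  [MeasurableSpace H] [BorelSpace H] [TopologicalSpace K] [CompactSpace K]
  [MeasurableSpace K] [BorelSpace K]

/-- The truncation of `[0, ∞]` at level `n`. -/
noncomputable def truncReal (n : ℕ) (m : ℝ≥0∞) : ℝ := (min m n).toReal

theorem continuous_truncReal (n : ℕ) : Continuous (truncReal n) :=
  ENNReal.continuousOn_toReal.comp_continuous (continuous_id.min continuous_const)
    fun _ => ((min_le_right _ _).trans_lt (ENNReal.natCast_lt_top n)).ne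

theorem truncReal_mono {n n' : ℕ} (h : n ≤ n') (m : ℝ≥0∞) : truncReal n m ≤ truncReal n' m :=
  ENNReal.toReal_mono ((min_le_right _ _).trans_lt (ENNReal.natCast_lt_top n')).ne
    (min_le_min le_rfl (by exact_mod_cast h))

theorem iSup_min_natCast (m : ℝ≥0∞) : ⨆ n : ℕ, min m n = m := by
  refine le_antisymm (iSup_le fun n => min_le_left _ _) (le_of_forall_lt fun r hr => ?_)
  obtain ⟨n, hn⟩ := ENNReal.exists_nat_gt hr.ne_top
  exact (lt_min hr hn).trans_le (le_iSup (fun n : ℕ => min m n) n)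

/-- The functions that integrate to something nonpositive as soon as the constraints hold: `k n` is
an approximation of the cost, the real number `M` bounds the moment. -/
def constraintCone (k : ℕ → H × (ProbabilityMeasure K × ℝ≥0∞) → ℝ) (hk : Monotone k)
    (r M : ℝ) (μ : Measure H) (ν : Measure K) [IsFiniteMeasure μ] [IsFiniteMeasure ν] :
    ConvexCone ℝ C(H × (ProbabilityMeasure K × ℝ≥0∞), ℝ) where
  carrier := {φ | ∃ (n : ℕ) (a b : ℝ) (f : C(H, ℝ)) (g : C(K, ℝ)), 0 ≤ a ∧ 0 ≤ b ∧
    ∀ z, φ z ≤ a * (k n z - r) + b * (truncReal n z.2.2 - M) + (f z.1 - ∫ x, f x ∂μ) +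
      ((∫ y, g y ∂(z.2.1 : Measure K)) - ∫ y, g y ∂ν)}
  smul_mem' := by
    rintro s hs φ ⟨n, a, b, f, g, ha, hb, h⟩
    refine ⟨n, s * a, s * b, s • f, s • g, by positivity, by positivity, fun z => ?_⟩
    have := mul_le_mul_of_nonneg_left (h z) hs.le
    simp only [ContinuousMap.smul_apply, smul_eq_mul, integral_const_mul]
    linarith
  add_mem' := by
    rintro φ ⟨n, a, b, f, g, ha, hb, h⟩ φ' ⟨n', a', b', f', g', ha', hb', h'⟩
    -- Both approximations increase in the index and `a`, `b` are nonnegative, so a common index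
    -- serves both summands.
    refine ⟨max n n', a + a', b + b', f + f', g + g', by positivity, by positivity, fun z => ?_⟩
    have h1 := mul_le_mul_of_nonneg_left (hk (le_max_left n n') z) ha
    have h2 := mul_le_mul_of_nonneg_left (hk (le_max_right n n') z) ha'
    have h3 := mul_le_mul_of_nonneg_left (truncReal_mono (le_max_left n n') z.2.2) hb
    have h4 := mul_le_mul_of_nonneg_left (truncReal_mono (le_max_right n n') z.2.2) hb'
    have hi : ∀ (m : Measure H) [IsFiniteMeasure m] (f : C(H, ℝ)), Integrable f m := fun m _ f =>
      (BoundedContinuousFunction.mkOfCompact f).integrable m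
    have hi' : ∀ (m : Measure K) [IsFiniteMeasure m] (f : C(K, ℝ)), Integrable f m := fun m _ f =>
      (BoundedContinuousFunction.mkOfCompact f).integrable m
    simp only [ContinuousMap.add_apply]
    rw [integral_add (hi _ _) (hi _ _), integral_add (hi' _ _) (hi' _ _),
      integral_add (hi' _ _) (hi' _ _)]
    linarith [h z, h' z]

/-- Either the relaxed problem on the compactification has a solution, or the constraints can be
combined to a dual certificate. -/
theorem exists_relaxed_or_certificate [MetrizableSpace H] [MetrizableSpace K]
    {h : ℕ → H × (ProbabilityMeasure K × ℝ≥0∞) → ℝ≥0∞}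
    (hc : ∀ n, Continuous (h n)) (hmono : Monotone h) (hN : ∀ n x, h n x ≤ n) (r M : ℝ)
    (μ : ProbabilityMeasure H) (ν : ProbabilityMeasure K) :
    (∃ P : ProbabilityMeasure (H × (ProbabilityMeasure K × ℝ≥0∞)),
      (∫⁻ z, ⨆ n, h n z ∂(P : Measure (H × (ProbabilityMeasure K × ℝ≥0∞)))) ≤ ENNReal.ofReal r ∧
      (∫⁻ z, z.2.2 ∂(P : Measure (H × (ProbabilityMeasure K × ℝ≥0∞)))) ≤ ENNReal.ofReal M ∧
      (P : Measure (H × (ProbabilityMeasure K × ℝ≥0∞))).map Prod.fst = μ ∧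
      ((P : Measure (H × (ProbabilityMeasure K × ℝ≥0∞))).map (fun z => z.2.1)).bind (evalKernel K)
        = ν) ∨
    ∃ (n : ℕ) (b : ℝ) (f : C(H, ℝ)) (g : C(K, ℝ)), 0 ≤ b ∧
      ∀ z, r + b * M + (∫ x, f x ∂(μ : Measure H)) + ∫ y, g y ∂(ν : Measure K) ≤
        (h n z).toReal + b * truncReal n z.2.2 + f z.1 + ∫ y, g y ∂(z.2.1 : Measure K) := by
  have hfin : ∀ n z, h n z ≠ ∞ := fun n z => ((hN n z).trans_lt (ENNReal.natCast_lt_top n)).ne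
  let k : ℕ → H × (ProbabilityMeasure K × ℝ≥0∞) → ℝ := fun n z => (h n z).toReal
  have hk : Monotone k := fun a b hab z => ENNReal.toReal_mono (hfin b z) (hmono hab z)
  have hkc : ∀ n, Continuous (k n) := fun n =>
    ENNReal.continuousOn_toReal.comp_continuous (hc n) (hfin n)
  have hk0 : ∀ n z, 0 ≤ k n z := fun n z => ENNReal.toReal_nonneg
  have ht0 : ∀ n m, 0 ≤ truncReal n m := fun n m => ENNReal.toReal_nonneg
  rcases exists_pos_mem_or_exists_probabilityMeasure
    (constraintCone k hk r M (μ : Measure H) (ν : Measure K))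
    ⟨0, 0, 0, 0, 0, le_rfl, le_rfl, fun z => by simp⟩ with ⟨φ, ⟨n, a, b, f, g, ha, hb, h⟩, hφ⟩ | hP
  · right
    rcases ha.eq_or_lt with rfl | ha
    · -- scale the certificate; the cost is nonnegative
      obtain ⟨ε, hε, hεφ⟩ : ∃ ε > 0, ∀ z, ε ≤ φ z := by
        obtain ⟨ε, hε, h⟩ := isCompact_univ.exists_forall_le' φ.continuous.continuousOn
          (fun z _ => hφ z)
        exact ⟨ε, hε, fun z => h z (mem_univ z)⟩
      let s : ℝ := |r| / ε
      have hs : 0 ≤ s := by positivity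
      refine ⟨n, s * b, s • f, s • g, by positivity, fun z => ?_⟩
      have h1 := mul_le_mul_of_nonneg_left ((hεφ z).trans (h z)) hs
      have h2 : s * ε = |r| := div_mul_cancel₀ _ hε.ne'
      have h3 := le_abs_self r
      have h4 := hk0 n z
      simp only [ContinuousMap.smul_apply, smul_eq_mul, integral_const_mul]
      simp only [k] at h4
      linarith
    · refine ⟨n, a⁻¹ * b, a⁻¹ • f, a⁻¹ • g, by positivity, fun z => ?_⟩
      have h1 := mul_le_mul_of_nonneg_left ((hφ z).le.trans (h z)) (inv_nonneg.2 ha.le)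
      have h2 : a⁻¹ * (a * (k n z - r)) = k n z - r := by rw [← mul_assoc, inv_mul_cancel₀ ha.ne',
        one_mul]
      simp only [ContinuousMap.smul_apply, smul_eq_mul, integral_const_mul]
      simp only [mul_add, h2] at h1
      simp only [k] at h1
      linarith
  · left
    obtain ⟨P, hP⟩ := hP
    have hint : ∀ φ : C(H × (ProbabilityMeasure K × ℝ≥0∞), ℝ),
        Integrable φ (P : Measure (H × (ProbabilityMeasure K × ℝ≥0∞))) := fun φ =>
      (BoundedContinuousFunction.mkOfCompact φ).integrable _
    have hle : ∀ (φ : C(H × (ProbabilityMeasure K × ℝ≥0∞), ℝ)) (s : ℝ),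
        φ - ContinuousMap.const _ s ∈ constraintCone k hk r M (μ : Measure H) (ν : Measure K) →
        ∫ z, φ z ∂(P : Measure (H × (ProbabilityMeasure K × ℝ≥0∞))) ≤ s := by
      intro φ s hφ
      have := hP _ hφ
      simp only [ContinuousMap.sub_apply, ContinuousMap.const_apply] at this
      rw [integral_sub (hint φ) (integrable_const s)] at this
      simpa using this
    have hsup : ∀ (w : ℕ → H × (ProbabilityMeasure K × ℝ≥0∞) → ℝ≥0∞) (s : ℝ),
        (∀ n, Continuous (w n)) → Monotone w → (∀ n z, w n z ≠ ∞) →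
        (∀ n, ∫ z, (w n z).toReal ∂(P : Measure (H × (ProbabilityMeasure K × ℝ≥0∞))) ≤ s) →
        ∫⁻ z, ⨆ n, w n z ∂(P : Measure (H × (ProbabilityMeasure K × ℝ≥0∞))) ≤
          ENNReal.ofReal s := by
      intro w s hw hwm hwt hws
      rw [lintegral_iSup (fun n => (hw n).measurable) hwm]
      refine iSup_le fun n => ?_
      have hc : Continuous fun z => (w n z).toReal :=
        ENNReal.continuousOn_toReal.comp_continuous (hw n) (hwt n)
      calc _ = ∫⁻ z, ENNReal.ofReal (w n z).toReal
            ∂(P : Measure (H × (ProbabilityMeasure K × ℝ≥0∞))) :=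
            lintegral_congr fun z => (ENNReal.ofReal_toReal (hwt n z)).symm
        _ ≤ _ := by
          have hi : Integrable (fun z => (w n z).toReal)
            (P : Measure (H × (ProbabilityMeasure K × ℝ≥0∞))) := hint ⟨_, hc⟩
          rw [← ofReal_integral_eq_lintegral_ofReal hi
            (ae_of_all _ fun z => ENNReal.toReal_nonneg)]
          exact ENNReal.ofReal_le_ofReal (hws n)
    refine ⟨P, ?_, ?_, ?_, ?_⟩
    · refine hsup h r hc hmono hfin fun n => ?_
      refine hle ⟨k n, hkc n⟩ r ⟨n, 1, 0, 0, 0, zero_le_one, le_rfl, fun z => ?_⟩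
      simp
    · have := hsup (fun n z => min z.2.2 n) M (fun n => by fun_prop)
        (fun a b hab z => min_le_min le_rfl (by exact_mod_cast hab))
        (fun n z => ((min_le_right _ _).trans_lt (ENNReal.natCast_lt_top n)).ne) fun n => ?_
      · simpa only [iSup_min_natCast] using this
      · refine hle ⟨fun z => truncReal n z.2.2, (continuous_truncReal n).comp (by fun_prop)⟩ M
          ⟨n, 0, 1, 0, 0, le_rfl, zero_le_one, fun z => ?_⟩
        simp
    · have := Measure.isProbabilityMeasure_map
        (μ := (P : Measure (H × (ProbabilityMeasure K × ℝ≥0∞)))) measurable_fst.aemeasurable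
      -- The cone contains the constraints for `f` and for `-f`, so these inequalities become
      -- equalities.
      have key : ∀ f : C(H, ℝ),
          ∫ z, f z.1 ∂(P : Measure (H × (ProbabilityMeasure K × ℝ≥0∞))) ≤ ∫ x, f x ∂(μ : Measure H) :=
        fun f => hle (f.comp ⟨Prod.fst, continuous_fst⟩) _
          ⟨0, 0, 0, f, 0, le_rfl, le_rfl, fun z => by simp⟩
      refine ext_of_forall_integral_eq_of_IsFiniteMeasure fun f => ?_
      rw [integral_map measurable_fst.aemeasurable f.continuous.aestronglyMeasurable]
      refine le_antisymm (key f.toContinuousMap) ?_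
      have := key (-f.toContinuousMap)
      simp only [ContinuousMap.neg_apply, integral_neg] at this
      exact neg_le_neg_iff.1 this
    · have hm : Measurable fun z : H × (ProbabilityMeasure K × ℝ≥0∞) => z.2.1 := by fun_prop
      have := Measure.isProbabilityMeasure_map
        (μ := (P : Measure (H × (ProbabilityMeasure K × ℝ≥0∞)))) hm.aemeasurable
      have key : ∀ g : C(K, ℝ), ∫ z, ∫ y, g y ∂(z.2.1 : Measure K)
          ∂(P : Measure (H × (ProbabilityMeasure K × ℝ≥0∞))) ≤ ∫ y, g y ∂(ν : Measure K) :=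
        fun g => hle ⟨fun z => ∫ y, g y ∂(z.2.1 : Measure K),
          (ProbabilityMeasure.continuous_integral_continuousMap g).comp (by fun_prop)⟩ _
          ⟨0, 0, 0, 0, g, le_rfl, le_rfl, fun z => by simp⟩
      refine (ProbabilityMeasure.bind_evalKernel_eq_iff _ ν).2 fun f => ?_
      rw [integral_map hm.aemeasurable (ProbabilityMeasure.measurable_integral
        f.continuous.measurable).aestronglyMeasurable]
      refine le_antisymm (key f.toContinuousMap) ?_
      have := key (-f.toContinuousMap)
      simp only [ContinuousMap.neg_apply, integral_neg] at this
      exact neg_le_neg_iff.1 this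

end Farkas

end WeakTransport

end

/-! ### From relaxed solutions to lifted couplings, and from certificates to potentials. -/

section

open Filter Topology TopologicalSpace ProbabilityTheory
open MeasureTheory.ProbabilityMeasure (evalKernel)

namespace WeakTransport

section Growth

variable {Y : Type*} [MetricSpace Y] {t : ℝ}

theorem toReal_edist_rpow (t : ℝ) (y y₀ : Y) : (edist y y₀ ^ t).toReal = dist y y₀ ^ t := by
  rw [← ENNReal.toReal_rpow, dist_edist]

/-- The shape of every potential produced in the proof: a bounded function from the compactification
and a nonnegative multiple of the moment integrand. -/
theorem add_dist_rpow_mem_PhiB (ht : 1 ≤ t) {g : Y → ℝ} (hg : Continuous g) {a : ℝ}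
    (ha : ∀ y, |g y| ≤ a) {b : ℝ} (hb : 0 ≤ b) (y₀ : Y) :
    (fun y => g y + b * dist y y₀ ^ t) ∈ PhiB Y t := by
  have h0 : ∀ y, 0 ≤ b * dist y y₀ ^ t := fun y =>
    mul_nonneg hb (Real.rpow_nonneg dist_nonneg t)
  refine ⟨hg.add (continuous_const.mul (Continuous.rpow_const (by fun_prop)
    fun _ => Or.inr (by linarith))), ⟨y₀, a, b, (abs_nonneg _).trans (ha y₀), hb, fun y => ?_⟩,
    -a, fun y => ?_⟩
  · refine (abs_add_le _ _).trans (add_le_add (ha y) (abs_of_nonneg (h0 y)).le)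
  · linarith [h0 y, neg_le_of_abs_le (ha y)]

variable [SecondCountableTopology Y] [MeasurableSpace Y] [BorelSpace Y]

theorem integrable_dist_rpow (ht : 1 ≤ t) {p : ProbabilityMeasure Y} (hp : HasFiniteMoment t p)
    (y₀ : Y) : Integrable (fun y => dist y y₀ ^ t) (p : Measure Y) := by
  simp_rw [← toReal_edist_rpow]
  exact integrable_toReal_of_lintegral_ne_top (by fun_prop)
    (moment_lt_top_of_hasFiniteMoment ht hp y₀).ne

theorem integral_dist_rpow (ht : 1 ≤ t) (p : ProbabilityMeasure Y) (y₀ : Y) :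
    ∫ y, dist y y₀ ^ t ∂(p : Measure Y) = (moment t y₀ p).toReal := by
  simp_rw [← toReal_edist_rpow]
  exact integral_toReal (by fun_prop) (ae_of_all _ fun y =>
    ENNReal.rpow_lt_top_of_nonneg (by linarith) (edist_ne_top _ _))

theorem PhiB.integrable (ht : 1 ≤ t) {ψ : Y → ℝ} (hψ : ψ ∈ PhiB Y t) {p : ProbabilityMeasure Y}
    (hp : HasFiniteMoment t p) : Integrable ψ (p : Measure Y) := by
  obtain ⟨hc, ⟨y₀, a, b, -, -, h⟩, -⟩ := hψ
  refine ((integrable_const a).add ((integrable_dist_rpow ht hp y₀).const_mul b)).mono'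
    hc.aestronglyMeasurable (ae_of_all _ h)

theorem integral_add_dist_rpow (ht : 1 ≤ t) {p : ProbabilityMeasure Y} (hp : HasFiniteMoment t p)
    {g : Y → ℝ} (hg : Integrable g (p : Measure Y)) (b : ℝ) (y₀ : Y) :
    ∫ y, (g y + b * dist y y₀ ^ t) ∂(p : Measure Y) =
      (∫ y, g y ∂(p : Measure Y)) + b * (moment t y₀ p).toReal := by
  rw [integral_add hg ((integrable_dist_rpow ht hp y₀).const_mul b), integral_const_mul,
    integral_dist_rpow ht]

end Growth

section Duality

variable {X Y H K : Type*} [TopologicalSpace X] [PolishSpace X] [MeasurableSpace X] [BorelSpace X]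
  [MetricSpace Y] [PolishSpace Y] [MeasurableSpace Y] [BorelSpace Y]
  [TopologicalSpace H] [MetrizableSpace H] [MeasurableSpace H] [BorelSpace H]
  [TopologicalSpace K] [CompactSpace K] [MetrizableSpace K] [MeasurableSpace K] [BorelSpace K]
  {t : ℝ}

/-- A relaxed solution on the compactification is concentrated on `X × P^t(Y)`. -/
theorem ae_mem_range_pairEmbed (ht : 1 ≤ t) (y₀ : Y) {iX : X → H} (hX : IsEmbedding iX) {i : Y → K}
    (hi : IsEmbedding i) {μ : ProbabilityMeasure X} {ν : ProbabilityMeasure Y}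
    (hν : HasFiniteMoment t ν) {P : Measure (H × (ProbabilityMeasure K × ℝ≥0∞))}
    (hcl : ∀ᵐ z ∂P, z ∈ closure (range fun z : X × WassersteinSpace Y t =>
        pairEmbed t y₀ iX hi (z.1, z.2.toProb)))
    (hmom : ∫⁻ z, z.2.2 ∂P ≤ moment t y₀ ν)
    (hfst : P.map Prod.fst = (μ : Measure X).map iX)
    (hsnd : (P.map fun z => z.2.1).bind (evalKernel K) = (ν : Measure Y).map i) :
    ∀ᵐ z ∂P, ∃ x p, HasFiniteMoment t p ∧ pairEmbed t y₀ iX hi (x, p) = z := by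
  have : Nonempty Y := ⟨y₀⟩
  have hX' := hX.continuous.measurableEmbedding hX.injective
  have hi' := hi.continuous.measurableEmbedding hi.injective
  have hm1 : Measurable fun z : H × (ProbabilityMeasure K × ℝ≥0∞) => z.2.1 := by fun_prop
  have hν' := moment_lt_top_of_hasFiniteMoment ht hν y₀
  have h1 : ∀ᵐ z ∂P, z.1 ∈ range iX := by
    have : ∀ᵐ x ∂(P.map Prod.fst), x ∈ range iX := by
      rw [hfst]
      exact (ae_map_iff hX'.measurable.aemeasurable hX'.measurableSet_range).2
        (ae_of_all _ mem_range_self)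
    exact ae_of_ae_map measurable_fst.aemeasurable this
  have h2 : ∀ᵐ z ∂P, (z.2.1 : Measure K) (range i) = 1 := by
    have := ProbabilityMeasure.ae_apply_eq_one_of_bind (Q := P.map fun z => z.2.1)
      hi'.measurableSet_range (by
        rw [hsnd, hi'.map_apply, preimage_compl, preimage_range, compl_univ, measure_empty])
    exact ae_of_ae_map hm1.aemeasurable this
  obtain ⟨h, hc, hmono, hN, hle, hsup⟩ := exists_continuous_approx_edist t y₀ hi
  let S : ProbabilityMeasure K → ℝ≥0∞ := fun u => ∫⁻ y, ⨆ n, h n y ∂(u : Measure K)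
  have hSm : Measurable S :=
    ProbabilityMeasure.measurable_lintegral (.iSup fun n => (hc n).measurable)
  have hS : ∀ u, S u = ⨆ n, ∫⁻ y, h n y ∂(u : Measure K) := fun u =>
    lintegral_iSup (fun n => (hc n).measurable) hmono
  have hSi : ∀ p, S (compactEmbed t y₀ hi p).1 = moment t y₀ p := fun p => by
    simp only [S]
    rw [lintegral_compactEmbed y₀ hi p (.iSup fun n => (hc n).measurable)]
    simp_rw [hsup]
    rfl
  -- Each approximant gives a closed condition that holds on the image, and so it persists on the
  -- closure: in the limit moment can escape but not be created.
  have h3 : ∀ᵐ z ∂P, S z.2.1 ≤ z.2.2 := by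
    filter_upwards [hcl] with z hz
    rw [hS]
    refine iSup_le fun n => ?_
    have hclosed : IsClosed {z : H × (ProbabilityMeasure K × ℝ≥0∞) |
        ∫⁻ y, h n y ∂(z.2.1 : Measure K) ≤ z.2.2} :=
      isClosed_le ((continuous_compactEmbed_lintegral (hc n) (hN n)).comp continuous_snd)
        (by fun_prop)
    refine closure_minimal ?_ hclosed hz
    rintro _ ⟨w, rfl⟩
    change ∫⁻ y, h n y ∂((compactEmbed t y₀ hi w.2.toProb).1 : Measure K) ≤ moment t y₀ w.2.toProb
    rw [lintegral_compactEmbed y₀ hi _ (hc n).measurable]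
    exact lintegral_mono fun y => hle n y
  have h4 : ∫⁻ z, S z.2.1 ∂P = moment t y₀ ν := by
    rw [← lintegral_map hSm hm1, ← hSi ν]
    change _ = ∫⁻ y, ⨆ n, h n y ∂((ν : Measure Y).map i)
    rw [← hsnd]
    exact (ProbabilityMeasure.lintegral_evalKernel_comp _ (.iSup fun n => (hc n).measurable)).symm
  -- An almost sure inequality whose integrals satisfy the reverse inequality, the smaller one being
  -- finite, is an equality.
  have h5 : (fun z => S z.2.1) =ᵐ[P] fun z => z.2.2 :=
    ae_eq_of_ae_le_of_lintegral_le h3 (by rw [h4]; exact hν'.ne) (by fun_prop) (by rwa [h4])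
  have h6 : ∀ᵐ z ∂P, S z.2.1 < ∞ :=
    ae_lt_top (hSm.comp hm1) (by rw [h4]; exact hν'.ne)
  filter_upwards [h1, h2, h5, h6] with z ⟨x, hx⟩ hz2 hz5 hz6
  obtain ⟨p, hp⟩ : z.2.1 ∈ range fun p : ProbabilityMeasure Y => p.map hi'.measurable.aemeasurable := by
    rw [ProbabilityMeasure.range_map hi']
    exact hz2
  have hpm : S z.2.1 = moment t y₀ p := by rw [← hSi p, ← hp]; rfl
  refine ⟨x, p, (hasFiniteMoment_iff ht y₀ p).2 (hpm ▸ hz6), ?_⟩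
  refine Prod.ext hx (Prod.ext hp ?_)
  change moment t y₀ p = z.2.2
  rw [← hpm]
  exact hz5

variable [CompactSpace H]

/-- A relaxed solution on the compactification comes from a lifted coupling. -/
theorem exists_liftedCoupling_map_eq (ht : 1 ≤ t) (y₀ : Y) {iX : X → H} (hX : IsEmbedding iX)
    {i : Y → K} (hi : IsEmbedding i) {μ : ProbabilityMeasure X} {ν : ProbabilityMeasure Y}
    (hν : HasFiniteMoment t ν) {P : Measure (H × (ProbabilityMeasure K × ℝ≥0∞))}
    [IsProbabilityMeasure P]
    (hcl : ∀ᵐ z ∂P, z ∈ closure (range fun z : X × WassersteinSpace Y t =>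
        pairEmbed t y₀ iX hi (z.1, z.2.toProb)))
    (hmom : ∫⁻ z, z.2.2 ∂P ≤ moment t y₀ ν)
    (hfst : P.map Prod.fst = (μ : Measure X).map iX)
    (hsnd : (P.map fun z => z.2.1).bind (evalKernel K) = (ν : Measure Y).map i) :
    ∃ P' ∈ liftedCouplings μ ν, (∀ᵐ z ∂(P' : Measure (X × ProbabilityMeasure Y)),
      HasFiniteMoment t z.2) ∧
      (P' : Measure (X × ProbabilityMeasure Y)).map (pairEmbed t y₀ iX hi) = P := by
  have hX' := hX.continuous.measurableEmbedding hX.injective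
  have hi' := hi.continuous.measurableEmbedding hi.injective
  have hm1 : Measurable fun z : H × (ProbabilityMeasure K × ℝ≥0∞) => z.2.1 := by fun_prop
  have he := measurableEmbedding_pairEmbed t y₀ hX hi
  have hae := ae_mem_range_pairEmbed ht y₀ hX hi hν hcl hmom hfst hsnd
  have hmap : (P.comap (pairEmbed t y₀ iX hi)).map (pairEmbed t y₀ iX hi) = P := by
    rw [he.map_comap]
    refine Measure.restrict_eq_self_of_ae_mem (hae.mono ?_)
    rintro z ⟨x, p, -, rfl⟩
    exact mem_range_self _
  have hprob : IsProbabilityMeasure (P.comap (pairEmbed t y₀ iX hi)) :=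
    ⟨by rw [← preimage_univ (f := pairEmbed t y₀ iX hi), ← he.map_apply, hmap, measure_univ]⟩
  set P' : Measure (X × ProbabilityMeasure Y) := P.comap (pairEmbed t y₀ iX hi) with hP'
  refine ⟨⟨P', hprob⟩, mem_liftedCouplings_iff.2 ⟨?_, ?_⟩, ?_, hmap⟩
  · rw [ProbabilityMeasure.coe_mk]
    have h1 : (P'.map Prod.fst).map iX = (μ : Measure X).map iX := by
      rw [← hfst, ← hmap, Measure.map_map hX'.measurable measurable_fst,
        Measure.map_map measurable_fst he.measurable]
      rfl
    rw [← hX'.comap_map (P'.map Prod.fst), h1, hX'.comap_map]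
  · rw [ProbabilityMeasure.coe_mk]
    have h1 : ((P'.map Prod.snd).bind (evalKernel Y)).map i = (ν : Measure Y).map i := by
      rw [← hsnd, ← hmap, Measure.map_map hm1 he.measurable]
      ext s hs
      rw [hi'.map_apply, ProbabilityMeasure.bind_evalKernel_apply _ (hi'.measurable hs),
        ProbabilityMeasure.bind_evalKernel_apply _ hs,
        lintegral_map (ProbabilityMeasure.measurable_apply (hi'.measurable hs)) measurable_snd,
        lintegral_map (ProbabilityMeasure.measurable_apply hs) (hm1.comp he.measurable)]
      refine lintegral_congr fun z => ?_
      exact (Measure.map_apply hi'.measurable hs).symm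
    rw [← hi'.comap_map ((P'.map Prod.snd).bind (evalKernel Y)), h1, hi'.comap_map]
  · rw [ProbabilityMeasure.coe_mk]
    rw [← hmap] at hae
    have := ae_of_ae_map he.measurable.aemeasurable hae
    filter_upwards [this] with z hz
    obtain ⟨x, p, hp, hxp⟩ := hz
    rw [← he.injective hxp]
    exact hp

/-- Alternative: either the lifted problem has a competitor of cost at most `r`, or there is a dual
certificate for `r`. -/
theorem exists_liftedCoupling_or_certificate [Nonempty Y] (ht : 1 ≤ t)
    {C : X × WassersteinSpace Y t → EReal} (hC : LowerSemicontinuous C) (c : ℝ)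
    (μ : ProbabilityMeasure X) (ν : WassersteinSpace Y t) (r : ℝ) :
    (∃ P ∈ liftedCouplings μ ν.toProb,
      ∫⁻ z, shiftCost C c z ∂(P : Measure (X × ProbabilityMeasure Y)) ≤ ENNReal.ofReal r) ∨
    ∃ ψ ∈ PhiB Y t, ∃ f : X →ᵇ ℝ, ∀ x (p : WassersteinSpace Y t),
      shiftCost C c (x, p.toProb) ≠ ∞ →
      r + (∫ x, f x ∂(μ : Measure X)) + ∫ y, ψ y ∂(ν.toProb : Measure Y) ≤
        (shiftCost C c (x, p.toProb)).toReal + f x + ∫ y, ψ y ∂(p.toProb : Measure Y) := by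
  obtain ⟨y₀⟩ := ‹Nonempty Y›
  let _ := upgradeIsCompletelyMetrizable X
  obtain ⟨iX, hX⟩ := Metric.PiNatEmbed.exists_embedding_to_hilbert_cube (X := X)
  obtain ⟨i, hi⟩ := Metric.PiNatEmbed.exists_embedding_to_hilbert_cube (X := Y)
  obtain ⟨h, hc, hmono, hN, hsup, htop⟩ := exists_continuous_approx_cost ht y₀ hX.isInducing hi hC c
  have hνt := moment_lt_top_of_hasFiniteMoment ht ν.finite_moment y₀
  rcases exists_relaxed_or_certificate hc hmono hN r (moment t y₀ ν.toProb).toReal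
    (μ.map hX.continuous.measurable.aemeasurable)
    (ν.toProb.map hi.continuous.measurable.aemeasurable) with
    ⟨P, hPr, hPm, hfst, hsnd⟩ | ⟨n, b, f, g, hb, hcert⟩
  · left
    have hhm : Measurable fun z => ⨆ n, h n z := .iSup fun n => (hc n).measurable
    have hcl : ∀ᵐ z ∂(P : Measure _), z ∈ closure (range fun z : X × WassersteinSpace Y t =>
        pairEmbed t y₀ iX hi (z.1, z.2.toProb)) := by
      filter_upwards [ae_lt_top hhm (hPr.trans_lt ENNReal.ofReal_lt_top).ne] with z hz
      by_contra hzc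
      exact hz.ne (htop z hzc)
    rw [ENNReal.ofReal_toReal hνt.ne] at hPm
    obtain ⟨P', hP', hfin, hmap⟩ := exists_liftedCoupling_map_eq ht y₀ hX hi ν.finite_moment hcl hPm
      hfst hsnd
    refine ⟨P', hP', le_trans (le_of_eq ?_) hPr⟩
    rw [← hmap, lintegral_map hhm (measurableEmbedding_pairEmbed t y₀ hX hi).measurable]
    refine lintegral_congr_ae ?_
    filter_upwards [hfin] with z hz
    exact (hsup z.1 z.2 hz).symm
  · right
    have hbd : ∀ y, |g (i y)| ≤ ‖g‖ := fun y => g.norm_coe_le_norm (i y)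
    have hgi : ∀ p : ProbabilityMeasure Y, Integrable (fun y => g (i y)) (p : Measure Y) := fun p =>
      Integrable.of_bound (g.continuous.comp hi.continuous).aestronglyMeasurable ‖g‖
        (ae_of_all _ hbd)
    -- The certificate involves `h n` and a truncated moment. Both lie below the true cost and
    -- moment, so replacing them keeps the inequality.
    refine ⟨_, add_dist_rpow_mem_PhiB ht (g.continuous.comp hi.continuous) hbd hb y₀,
      (BoundedContinuousFunction.mkOfCompact f).compContinuous ⟨iX, hX.continuous⟩,
      fun x p hxp => ?_⟩
    have hpt := moment_lt_top_of_hasFiniteMoment ht p.finite_moment y₀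
    have h1 := hcert (pairEmbed t y₀ iX hi (x, p.toProb))
    have h2 : (h n (pairEmbed t y₀ iX hi (x, p.toProb))).toReal ≤
        (shiftCost C c (x, p.toProb)).toReal := by
      refine ENNReal.toReal_mono hxp ?_
      rw [← hsup x p.toProb p.finite_moment]
      exact le_iSup (fun n => h n (pairEmbed t y₀ iX hi (x, p.toProb))) n
    have h3 : truncReal n (moment t y₀ p.toProb) ≤ (moment t y₀ p.toProb).toReal :=
      ENNReal.toReal_mono hpt.ne (min_le_left _ _)
    have h4 := mul_le_mul_of_nonneg_left h3 hb
    have h5 : ∫ y, g y ∂((pairEmbed t y₀ iX hi (x, p.toProb)).2.1 : Measure _) =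
      ∫ y, g (i y) ∂(p.toProb : Measure Y) := integral_compactEmbed y₀ hi p.toProb g
    have h6 : ∫ y, g y ∂((ν.toProb.map hi.continuous.measurable.aemeasurable :
        ProbabilityMeasure _) : Measure _) = ∫ y, g (i y) ∂(ν.toProb : Measure Y) :=
      integral_map hi.continuous.measurable.aemeasurable g.continuous.aestronglyMeasurable
    have h7 : ∫ y, f y ∂((μ.map hX.continuous.measurable.aemeasurable :
        ProbabilityMeasure _) : Measure _) = ∫ x, f (iX x) ∂(μ : Measure X) :=
      integral_map hX.continuous.measurable.aemeasurable f.continuous.aestronglyMeasurable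
    have h8 : (pairEmbed t y₀ iX hi (x, p.toProb)).1 = iX x := rfl
    have h9 : (pairEmbed t y₀ iX hi (x, p.toProb)).2.2 = moment t y₀ p.toProb := rfl
    have h10 := integral_add_dist_rpow ht ν.finite_moment (hgi ν.toProb) b y₀
    have h11 := integral_add_dist_rpow ht p.finite_moment (hgi p.toProb) b y₀
    rw [h5, h6, h7, h8, h9] at h1
    simp only [Function.comp_apply, h10, h11, BoundedContinuousFunction.compContinuous_apply,
      ContinuousMap.coe_mk, BoundedContinuousFunction.mkOfCompact_apply]
    linarith

end Duality

end WeakTransport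

end

/-! ### Measurability of the conjugate, weak duality, and equality for the lifted problem. -/

section

open Filter Topology TopologicalSpace ProbabilityTheory
open MeasureTheory.ProbabilityMeasure (evalKernel)

namespace WeakTransport

theorem le_eintegral {Z : Type*} [MeasurableSpace Z] {m : Measure Z} [IsProbabilityMeasure m]
    {f : Z → EReal} (hf : AEMeasurable f m) {k : Z → ℝ} (hk : Integrable k m) {d : ℝ}
    (hd : ∀ z, d ≤ k z) (hkf : ∀ z, (k z : EReal) ≤ f z) :
    ((∫ z, k z ∂m : ℝ) : EReal) ≤ eintegral m f := by
  rw [eintegral_eq_lintegral_add hf fun z => (EReal.coe_le_coe_iff.2 (hd z)).trans (hkf z)]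
  have h1 : ENNReal.ofReal ((∫ z, k z ∂m) - d) ≤ ∫⁻ z, (f z - d).toENNReal ∂m := by
    have h2 : (∫ z, k z ∂m) - d = ∫ z, (k z - d) ∂m := by
      rw [integral_sub hk (integrable_const d)]; simp
    have hi : Integrable (fun z => k z - d) m := hk.sub (integrable_const d)
    rw [h2, ofReal_integral_eq_lintegral_ofReal hi
      (ae_of_all _ fun z => sub_nonneg.2 (hd z))]
    refine lintegral_mono fun z => ?_
    have := EReal.toENNReal_le_toENNReal (EReal.sub_le_sub (hkf z) (le_refl (d : EReal)))
    rwa [← EReal.coe_sub, EReal.toENNReal_of_ne_top (EReal.coe_ne_top _), EReal.toReal_coe] at this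
  have h3 : (((∫ z, k z ∂m) - d : ℝ) : EReal) ≤ ((∫⁻ z, (f z - d).toENNReal ∂m : ℝ≥0∞) : EReal) :=
    le_trans (by rw [EReal.coe_ennreal_ofReal]; exact EReal.coe_le_coe_iff.2 (le_max_left _ _))
      (EReal.coe_ennreal_le_coe_ennreal_iff.2 h1)
  calc ((∫ z, k z ∂m : ℝ) : EReal) = (((∫ z, k z ∂m) - d : ℝ) : EReal) + d := by
        rw [← EReal.coe_add, sub_add_cancel]
    _ ≤ _ := add_le_add_left h3 _

section Intensity

variable {Y : Type*} [MetricSpace Y] [SecondCountableTopology Y] [MeasurableSpace Y] [BorelSpace Y]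
  {t : ℝ}

omit [SecondCountableTopology Y] in
theorem ae_hasFiniteMoment (ht : 1 ≤ t) {Q : Measure (ProbabilityMeasure Y)}
    {ν : ProbabilityMeasure Y} (hν : HasFiniteMoment t ν) (hQ : Q.bind (evalKernel Y) = ν) :
    ∀ᵐ p ∂Q, HasFiniteMoment t p := by
  obtain ⟨y₀⟩ := ν.nonempty
  have h1 : ∫⁻ p, moment t y₀ p ∂Q = moment t y₀ ν := by
    rw [moment, ← hQ, ProbabilityMeasure.lintegral_evalKernel_comp Q (by fun_prop)]
    rfl
  filter_upwards [ae_lt_top (measurable_moment t y₀)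
    (h1 ▸ (moment_lt_top_of_hasFiniteMoment ht hν y₀).ne)] with p hp
  exact (hasFiniteMoment_iff ht y₀ p).2 hp

theorem ofReal_integral_sub (ht : 1 ≤ t) {ψ : Y → ℝ} (hψ : ψ ∈ PhiB Y t) {l : ℝ}
    (hl : ∀ y, l ≤ ψ y) {p : ProbabilityMeasure Y} (hp : HasFiniteMoment t p) :
    ENNReal.ofReal ((∫ y, ψ y ∂(p : Measure Y)) - l) =
      ∫⁻ y, ENNReal.ofReal (ψ y - l) ∂(p : Measure Y) := by
  have hi : Integrable (fun y => ψ y - l) (p : Measure Y) :=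
    (PhiB.integrable ht hψ hp).sub (integrable_const l)
  rw [← ofReal_integral_eq_lintegral_ofReal hi
    (ae_of_all _ fun y => sub_nonneg.2 (hl y)),
    integral_sub (PhiB.integrable ht hψ hp) (integrable_const l)]
  simp

theorem le_integral_of_mem_PhiB (ht : 1 ≤ t) {ψ : Y → ℝ} (hψ : ψ ∈ PhiB Y t) {l : ℝ}
    (hl : ∀ y, l ≤ ψ y) {p : ProbabilityMeasure Y} (hp : HasFiniteMoment t p) :
    l ≤ ∫ y, ψ y ∂(p : Measure Y) := by
  have := integral_mono (μ := (p : Measure Y)) (integrable_const l) (PhiB.integrable ht hψ hp) hl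
  simpa using this

theorem lintegral_ofReal_integral_sub (ht : 1 ≤ t) {Q : Measure (ProbabilityMeasure Y)}
    {ν : ProbabilityMeasure Y} (hν : HasFiniteMoment t ν) (hQ : Q.bind (evalKernel Y) = ν)
    {ψ : Y → ℝ} (hψ : ψ ∈ PhiB Y t) {l : ℝ} (hl : ∀ y, l ≤ ψ y) :
    ∫⁻ p, ENNReal.ofReal ((∫ y, ψ y ∂(p : Measure Y)) - l) ∂Q =
      ENNReal.ofReal ((∫ y, ψ y ∂(ν : Measure Y)) - l) := by
  have hψm := hψ.1.measurable
  rw [ofReal_integral_sub ht hψ hl hν, ← hQ,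
    ProbabilityMeasure.lintegral_evalKernel_comp Q (by fun_prop)]
  refine lintegral_congr_ae ?_
  filter_upwards [ae_hasFiniteMoment ht hν hQ] with p hp
  exact ofReal_integral_sub ht hψ hl hp

omit [SecondCountableTopology Y] in
theorem measurable_ofReal_integral_sub {ψ : Y → ℝ} (hψ : ψ ∈ PhiB Y t) (l : ℝ) :
    Measurable fun p : ProbabilityMeasure Y =>
      ENNReal.ofReal ((∫ y, ψ y ∂(p : Measure Y)) - l) :=
  ((ProbabilityMeasure.measurable_integral hψ.1.measurable).sub_const l).ennreal_ofReal

end Intensity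

section Duality

variable {X Y : Type*} [TopologicalSpace X] [PolishSpace X] [MeasurableSpace X] [BorelSpace X]
  [MetricSpace Y] [PolishSpace Y] [MeasurableSpace Y] [BorelSpace Y] [Nonempty Y] {t : ℝ}
  {C : X × WassersteinSpace Y t → EReal}

theorem le_conjugate {X Y : Type*} [MetricSpace Y] [SecondCountableTopology Y] [MeasurableSpace Y]
    [BorelSpace Y] {t : ℝ} (ht : 1 ≤ t) {C : X × WassersteinSpace Y t → EReal} {c : ℝ}
    (hc : ∀ z, (c : EReal) ≤ C z) {ψ : Y → ℝ} (hψ : ψ ∈ PhiB Y t) {l : ℝ} (hl : ∀ y, l ≤ ψ y)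
    (x : X) : ((l + c : ℝ) : EReal) ≤ conjugate C ψ x := by
  refine le_iInf fun p => ?_
  rw [EReal.coe_add]
  exact add_le_add (EReal.coe_le_coe_iff.2 (le_integral_of_mem_PhiB ht hψ hl p.finite_moment)) (hc _)

/-- A strict sublevel set of an infimum over `p` is the projection of a Borel subset of `X × P(Y)`.
It is therefore analytic, and measurable for the completion of every finite measure. -/
theorem aemeasurable_conjugate (ht : 1 ≤ t) (hC : ConditionA C) {ψ : Y → ℝ} (hψ : ψ ∈ PhiB Y t)
    (μ : Measure X) [IsFiniteMeasure μ] : AEMeasurable (conjugate C ψ) μ := by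
  have := ProbabilityMeasure.standardBorelSpace (Y := Y)
  obtain ⟨y₀⟩ := ‹Nonempty Y›
  have hlt : ∀ r : EReal, NullMeasurableSet {x | conjugate C ψ x < r} μ := by
    intro r
    let A : Set (X × ProbabilityMeasure Y) := {z | moment t y₀ z.2 < ∞ ∧
      ((∫ y, ψ y ∂(z.2 : Measure Y) : ℝ) : EReal) + extendCost C z < r}
    have hA : MeasurableSet A := by
      refine (measurableSet_lt ((measurable_moment t y₀).comp measurable_snd)
        measurable_const).inter (measurableSet_lt (Measurable.add ?_ (measurable_extendCost ht hC))
        measurable_const)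
      exact ((ProbabilityMeasure.measurable_integral hψ.1.measurable).comp
        measurable_snd).coe_real_ereal
    have himg : {x | conjugate C ψ x < r} = Prod.fst '' A := by
      ext x
      constructor
      · intro hx
        have hx' : conjugate C ψ x < r := hx
        obtain ⟨p, hp⟩ := iInf_lt_iff.1 hx'
        refine ⟨(x, p.toProb), ⟨moment_lt_top_of_hasFiniteMoment ht p.finite_moment y₀, ?_⟩, rfl⟩
        rwa [extendCost_toProb]
      · rintro ⟨⟨x', p⟩, ⟨hp, hlt⟩, rfl⟩
        have hp' := (hasFiniteMoment_iff ht y₀ p).2 hp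
        rw [mem_ofPred_eq]
        refine iInf_lt_iff.2 ⟨(⟨p, hp'⟩ : WassersteinSpace Y t), ?_⟩
        rwa [← extendCost_toProb C]
    rw [himg]
    exact (hA.analyticSet_image measurable_fst).nullMeasurableSet μ
  have : NullMeasurable (conjugate C ψ) μ :=
    @measurable_of_Iio _ (NullMeasurableSpace X μ) _ _ _ _ _ _ _ _ hlt
  exact this.aemeasurable

/-- The defining inequality of the conjugate, integrated against `P`. The shifts by the lower bounds
`l` and `c` keep all integrands in `[0, ∞]` and cancel at the end. -/
theorem dual_le_lifted (ht : 1 ≤ t) (hC : ConditionA C) {μ : ProbabilityMeasure X}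
    {ν : ProbabilityMeasure Y} (hν : HasFiniteMoment t ν) {ψ : Y → ℝ} (hψ : ψ ∈ PhiB Y t)
    {P : ProbabilityMeasure (X × ProbabilityMeasure Y)} (hP : P ∈ liftedCouplings μ ν) :
    -((∫ y, ψ y ∂(ν : Measure Y) : ℝ) : EReal) + eintegral (μ : Measure X) (conjugate C ψ) ≤
      eintegral (P : Measure (X × ProbabilityMeasure Y)) (extendCost C) := by
  obtain ⟨c, hc⟩ := hC.bddBelow
  obtain ⟨l, hl⟩ := hψ.2.2
  obtain ⟨hP1, hP2⟩ := mem_liftedCouplings_iff.1 hP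
  have hconj := aemeasurable_conjugate ht hC hψ (μ : Measure X)
  rw [eintegral_eq_lintegral_add hconj fun x => le_conjugate ht hc hψ hl x,
    eintegral_eq_lintegral_add (measurable_extendCost ht hC).aemeasurable (le_extendCost hc)]
  have hpt : ∀ z : X × ProbabilityMeasure Y, (conjugate C ψ z.1 - ((l + c : ℝ) : EReal)).toENNReal ≤
      shiftCost C c z + ENNReal.ofReal ((∫ y, ψ y ∂(z.2 : Measure Y)) - l) := by
    rintro ⟨x, p⟩
    by_cases hp : HasFiniteMoment t p
    · rw [toENNReal_sub_le_iff]
      have h1 : conjugate C ψ x ≤ ((∫ y, ψ y ∂(p : Measure Y) : ℝ) : EReal) + C (x, ⟨p, hp⟩) :=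
        iInf_le _ (⟨p, hp⟩ : WassersteinSpace Y t)
      refine h1.trans (le_of_eq ?_)
      rw [← extendCost_toProb C, ← coe_shiftCost_add hc, EReal.coe_ennreal_add,
        EReal.coe_ennreal_ofReal,
        max_eq_left (sub_nonneg.2 (le_integral_of_mem_PhiB ht hψ hl hp))]
      have : ((∫ y, ψ y ∂(p : Measure Y) : ℝ) : EReal) =
          (((∫ y, ψ y ∂(p : Measure Y)) - l : ℝ) : EReal) + (l : EReal) := by
        rw [← EReal.coe_add, sub_add_cancel]
      rw [this, EReal.coe_add]
      ac_rfl
    · rw [shiftCost, extendCost_of_not_hasFiniteMoment C x hp]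
      simp
  have hint : ∫⁻ x, (conjugate C ψ x - ((l + c : ℝ) : EReal)).toENNReal ∂(μ : Measure X) ≤
      (∫⁻ z, shiftCost C c z ∂(P : Measure (X × ProbabilityMeasure Y))) +
        ENNReal.ofReal ((∫ y, ψ y ∂(ν : Measure Y)) - l) := by
    have hm : AEMeasurable (fun x => (conjugate C ψ x - ((l + c : ℝ) : EReal)).toENNReal)
        (μ : Measure X) := (hconj.sub_const _).ereal_toENNReal
    rw [← lintegral_ofReal_integral_sub ht hν hP2 hψ hl,
      lintegral_map (measurable_ofReal_integral_sub hψ l) measurable_snd,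
      ← lintegral_add_left (measurable_shiftCost ht hC.lsc c)]
    rw [← hP1] at hm ⊢
    rw [lintegral_map' hm measurable_fst.aemeasurable]
    exact lintegral_mono hpt
  have hνl : 0 ≤ (∫ y, ψ y ∂(ν : Measure Y)) - l :=
    sub_nonneg.2 (le_integral_of_mem_PhiB ht hψ hl hν)
  have hint' := EReal.coe_ennreal_le_coe_ennreal_iff.2 hint
  rw [EReal.coe_ennreal_add, EReal.coe_ennreal_ofReal, max_eq_left hνl] at hint'
  refine (add_le_add_right (add_le_add_left hint' _) _).trans (le_of_eq ?_)
  change _ = ((∫⁻ z, shiftCost C c z ∂(P : Measure (X × ProbabilityMeasure Y)) : ℝ≥0∞) : EReal) + c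
  rw [← EReal.coe_neg, add_assoc, add_left_comm, ← EReal.coe_add, ← EReal.coe_add]
  congr 2
  ring

/-- The certificate bounds the conjugate of `ψ` from below by a constant minus `f`. After
integration against `μ` the function `f` cancels. -/
theorem le_dualValue_of_certificate (ht : 1 ≤ t) (hC : ConditionA C) {c : ℝ}
    (hc : ∀ z, (c : EReal) ≤ C z) {μ : ProbabilityMeasure X} {ν : ProbabilityMeasure Y} {r : ℝ}
    {ψ : Y → ℝ} (hψ : ψ ∈ PhiB Y t) (f : X →ᵇ ℝ)
    (h : ∀ x (p : WassersteinSpace Y t), shiftCost C c (x, p.toProb) ≠ ∞ →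
      r + (∫ x, f x ∂(μ : Measure X)) + ∫ y, ψ y ∂(ν : Measure Y) ≤
        (shiftCost C c (x, p.toProb)).toReal + f x + ∫ y, ψ y ∂(p.toProb : Measure Y)) :
    ((r + c : ℝ) : EReal) ≤ dualValue C μ ν := by
  refine le_trans ?_ (le_iSup₂ (f := fun ψ (_ : ψ ∈ PhiB Y t) =>
    -((∫ y, ψ y ∂(ν : Measure Y) : ℝ) : EReal) + eintegral (μ : Measure X) (conjugate C ψ)) ψ hψ)
  have hfi : Integrable f (μ : Measure X) := f.integrable _
  set A : ℝ := r + (∫ x, f x ∂(μ : Measure X)) + (∫ y, ψ y ∂(ν : Measure Y)) + c with hA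
  have hle := le_eintegral (aemeasurable_conjugate ht hC hψ (μ : Measure X))
    (k := fun x => A - f x) ((integrable_const A).sub hfi) (d := A - ‖f‖)
    (fun x => sub_le_sub_left (le_of_abs_le (f.norm_coe_le_norm x)) A) fun x => by
      refine le_iInf fun p => ?_
      rw [← extendCost_toProb C, ← coe_shiftCost_add hc]
      rcases eq_or_ne (shiftCost C c (x, p.toProb)) ∞ with htop | htop
      · rw [htop]
        simp
      · have := h x p htop
        rw [← ENNReal.ofReal_toReal htop, EReal.coe_ennreal_ofReal,
          max_eq_left ENNReal.toReal_nonneg, ← EReal.coe_add, ← EReal.coe_add,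
          EReal.coe_le_coe_iff]
        linarith
  rw [integral_sub (integrable_const A) hfi] at hle
  simp only [integral_const, probReal_univ, one_smul] at hle
  refine le_trans (le_of_eq ?_) (add_le_add_right hle _)
  rw [← EReal.coe_neg, ← EReal.coe_add, EReal.coe_eq_coe_iff, hA]
  ring

/-- For a real `s` below the lifted value no competitor costs at most `s`, so the alternative leaves
only a certificate for `s`. -/
theorem liftedValue_eq_dualValue (ht : 1 ≤ t) (hC : ConditionA C) (μ : ProbabilityMeasure X)
    (ν : WassersteinSpace Y t) : liftedValue C μ ν.toProb = dualValue C μ ν.toProb := by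
  apply le_antisymm
  · rw [← EReal.ge_of_forall_gt_iff_ge]
    intro s hs
    obtain ⟨c₀, hc₀⟩ := hC.bddBelow
    -- Lowering the bound to `s` if necessary makes `s - c` nonnegative, so `ENNReal.ofReal` does
    -- not truncate it.
    let c : ℝ := min c₀ s
    have hc : ∀ z, (c : EReal) ≤ C z := fun z =>
      (EReal.coe_le_coe_iff.2 (min_le_left _ _)).trans (hc₀ z)
    rcases exists_liftedCoupling_or_certificate ht hC.lsc c μ ν (s - c) with
      ⟨P, hP, hPc⟩ | ⟨ψ, hψ, f, h⟩
    · exfalso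
      have h1 : liftedValue C μ ν.toProb ≤ s := by
        refine (iInf₂_le P hP).trans ?_
        rw [eintegral_eq_lintegral_add (measurable_extendCost ht hC).aemeasurable
          (le_extendCost hc)]
        refine (add_le_add_left (EReal.coe_ennreal_le_coe_ennreal_iff.2 hPc) _).trans (le_of_eq ?_)
        rw [EReal.coe_ennreal_ofReal, max_eq_left (sub_nonneg.2 (min_le_right _ _)),
          ← EReal.coe_add, sub_add_cancel]
      exact absurd hs (not_lt.2 h1)
    · have := le_dualValue_of_certificate ht hC hc hψ f h
      rwa [sub_add_cancel] at this
  · exact iSup₂_le fun ψ hψ => le_iInf₂ fun P hP => dual_le_lifted ht hC ν.finite_moment hψ hP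

end Duality

end WeakTransport

end

/-! ### Affine minorants of convex lower semicontinuous costs. -/

section

open Filter Topology TopologicalSpace ProbabilityTheory
open MeasureTheory.ProbabilityMeasure (evalKernel)

/-- The filter generated by finitely many integral tests converges weakly to `u`, so it contains
every neighbourhood of `u`. -/
theorem MeasureTheory.ProbabilityMeasure.exists_finset_integral_sub_lt_subset {K : Type*}
    [TopologicalSpace K] [MeasurableSpace K] [BorelSpace K]
    {u : ProbabilityMeasure K} {U : Set (ProbabilityMeasure K)} (hU : U ∈ 𝓝 u) :
    ∃ (s : Finset C(K, ℝ)) (δ : ℝ), 0 < δ ∧ ∀ u' : ProbabilityMeasure K,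
      (∀ g ∈ s, |(∫ x, g x ∂(u' : Measure K)) - ∫ x, g x ∂(u : Measure K)| < δ) → u' ∈ U := by
  classical
  let B : Finset C(K, ℝ) × {δ : ℝ // 0 < δ} → Set (ProbabilityMeasure K) := fun a =>
    {u' | ∀ g ∈ a.1, |(∫ x, g x ∂(u' : Measure K)) - ∫ x, g x ∂(u : Measure K)| < a.2}
  have hB : Directed (· ⊇ ·) B := by
    rintro ⟨s₁, δ₁⟩ ⟨s₂, δ₂⟩
    refine ⟨(s₁ ∪ s₂, ⟨min δ₁ δ₂, lt_min δ₁.2 δ₂.2⟩), fun u' hu' g hg => ?_, fun u' hu' g hg => ?_⟩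
    · exact (hu' g (Finset.mem_union_left _ hg)).trans_le (min_le_left _ _)
    · exact (hu' g (Finset.mem_union_right _ hg)).trans_le (min_le_right _ _)
  have : Nonempty (Finset C(K, ℝ) × {δ : ℝ // 0 < δ}) := ⟨(∅, ⟨1, one_pos⟩)⟩
  have hbasis := Filter.hasBasis_iInf_principal hB
  have hlim : Tendsto id (⨅ a, 𝓟 (B a)) (𝓝 u) := by
    rw [ProbabilityMeasure.tendsto_iff_forall_integral_tendsto]
    intro f
    rw [Metric.tendsto_nhds]
    intro ε hε
    have hmem := hbasis.mem_of_mem (i := ({(f : C(K, ℝ))}, ⟨ε, hε⟩)) trivial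
    filter_upwards [hmem] with u' hu'
    exact hu' f (Finset.mem_singleton_self _)
  obtain ⟨⟨s, δ⟩, -, hs⟩ := hbasis.mem_iff.1 (hlim hU)
  exact ⟨s, δ, δ.2, fun u' hu' => hs hu'⟩

namespace WeakTransport

section Mixture

variable {Y : Type*} [MetricSpace Y] [MeasurableSpace Y] {t : ℝ}

theorem exists_mixture (ht : 1 ≤ t) (p q : WassersteinSpace Y t) {α β : ℝ} (hα : 0 ≤ α)
    (hβ : 0 ≤ β) (hαβ : α + β = 1) : ∃ r : WassersteinSpace Y t, (r.toProb : Measure Y) =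
      ENNReal.ofReal α • (p.toProb : Measure Y) + ENNReal.ofReal β • (q.toProb : Measure Y) := by
  obtain ⟨y₀⟩ := p.toProb.nonempty
  let m : Measure Y :=
    ENNReal.ofReal α • (p.toProb : Measure Y) + ENNReal.ofReal β • (q.toProb : Measure Y)
  have hm : IsProbabilityMeasure m := ⟨by
    simp only [m, Measure.add_apply, Measure.smul_apply, measure_univ, smul_eq_mul, mul_one]
    rw [← ENNReal.ofReal_add hα hβ, hαβ, ENNReal.ofReal_one]⟩
  refine ⟨⟨⟨m, hm⟩, y₀, ?_⟩, rfl⟩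
  change ∫⁻ y, edist y y₀ ^ t ∂m < ∞
  rw [lintegral_add_measure, lintegral_smul_measure, lintegral_smul_measure]
  exact ENNReal.add_lt_top.2
    ⟨ENNReal.mul_lt_top ENNReal.ofReal_lt_top
      (moment_lt_top_of_hasFiniteMoment ht p.finite_moment y₀),
    ENNReal.mul_lt_top ENNReal.ofReal_lt_top
      (moment_lt_top_of_hasFiniteMoment ht q.finite_moment y₀)⟩

omit [MetricSpace Y] in
theorem integral_mixture {p q r : Measure Y} {α β : ℝ} (hα : 0 ≤ α) (hβ : 0 ≤ β)
    (hr : r = ENNReal.ofReal α • p + ENNReal.ofReal β • q) {f : Y → ℝ}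
    (hp : Integrable f p) (hq : Integrable f q) :
    ∫ y, f y ∂r = α * (∫ y, f y ∂p) + β * ∫ y, f y ∂q := by
  rw [hr, integral_add_measure (hp.smul_measure ENNReal.ofReal_ne_top)
    (hq.smul_measure ENNReal.ofReal_ne_top), integral_smul_measure, integral_smul_measure,
    ENNReal.toReal_ofReal hα, ENNReal.toReal_ofReal hβ, smul_eq_mul, smul_eq_mul]

theorem toReal_moment_mixture (ht : 1 ≤ t) {p q r : WassersteinSpace Y t} {α β : ℝ} (hα : 0 ≤ α)
    (hβ : 0 ≤ β) (hr : (r.toProb : Measure Y) =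
      ENNReal.ofReal α • (p.toProb : Measure Y) + ENNReal.ofReal β • (q.toProb : Measure Y))
    (y₀ : Y) : (moment t y₀ r.toProb).toReal =
      α * (moment t y₀ p.toProb).toReal + β * (moment t y₀ q.toProb).toReal := by
  have hp := (moment_lt_top_of_hasFiniteMoment ht p.finite_moment y₀).ne
  have hq := (moment_lt_top_of_hasFiniteMoment ht q.finite_moment y₀).ne
  have : moment t y₀ r.toProb = ENNReal.ofReal α * moment t y₀ p.toProb +
      ENNReal.ofReal β * moment t y₀ q.toProb := by
    simp only [moment]
    rw [hr, lintegral_add_measure, lintegral_smul_measure, lintegral_smul_measure]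
    rfl
  rw [this, ENNReal.toReal_add (ENNReal.mul_ne_top ENNReal.ofReal_ne_top hp)
    (ENNReal.mul_ne_top ENNReal.ofReal_ne_top hq), ENNReal.toReal_mul, ENNReal.toReal_mul,
    ENNReal.toReal_ofReal hα, ENNReal.toReal_ofReal hβ]

end Mixture

section AffineMinorant

variable {X Y : Type*} [TopologicalSpace X] [MetricSpace Y] [PolishSpace Y] [MeasurableSpace Y]
  [BorelSpace Y] {t : ℝ} {C : X × WassersteinSpace Y t → EReal}

/-- Superlevel sets of an lsc cost contain weak neighbourhoods, up to a one-sided bound on the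
moment. -/
theorem exists_finset_lt_cost {K : Type*} [TopologicalSpace K] [CompactSpace K] [MetrizableSpace K]
    [MeasurableSpace K] [BorelSpace K] (ht : 1 ≤ t) (y₀ : Y) {i : Y → K} (hi : IsEmbedding i)
    (hC : LowerSemicontinuous C) {x : X} {q : WassersteinSpace Y t} {r : EReal} (hr : r < C (x, q)) :
    ∃ (s : Finset C(K, ℝ)) (δ : ℝ), 0 < δ ∧ ∀ p : WassersteinSpace Y t,
      (∀ g ∈ s, |(∫ y, g (i y) ∂(p.toProb : Measure Y)) - ∫ y, g (i y) ∂(q.toProb : Measure Y)| <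
        δ) →
      (moment t y₀ p.toProb).toReal - (moment t y₀ q.toProb).toReal < δ → r < C (x, p) := by
  have hfin : ∀ p : WassersteinSpace Y t, moment t y₀ p.toProb ≠ ∞ := fun p =>
    (moment_lt_top_of_hasFiniteMoment ht p.finite_moment y₀).ne
  obtain ⟨O, hO, hqO, hOC⟩ := exists_isOpen_lt_cost ht y₀ (IsInducing.id (X := X)) hi hC hr
  have hnhds : {w : ProbabilityMeasure K × ℝ≥0∞ | (x, w) ∈ O} ∈
      𝓝 ((compactEmbed t y₀ hi q.toProb).1, moment t y₀ q.toProb) :=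
    (hO.preimage (Continuous.prodMk_right x)).mem_nhds hqO
  obtain ⟨U, hU, W, hW, hUW⟩ := mem_nhds_prod_iff.1 hnhds
  obtain ⟨δ₁, hδ₁, hδW⟩ : ∃ δ₁ > 0, ∀ a : ℝ, |a - (moment t y₀ q.toProb).toReal| < δ₁ →
      ENNReal.ofReal a ∈ W := by
    have : ENNReal.ofReal ⁻¹' W ∈ 𝓝 (moment t y₀ q.toProb).toReal :=
      ENNReal.continuous_ofReal.continuousAt (by rwa [ENNReal.ofReal_toReal (hfin q)])
    obtain ⟨δ₁, hδ₁, h⟩ := Metric.mem_nhds_iff.1 this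
    exact ⟨δ₁, hδ₁, fun a ha => h ha⟩
  -- The moment is a supremum of weakly continuous functions, so weak closeness alone prevents it
  -- from dropping. Only its upper bound has to be assumed.
  obtain ⟨U', hU', hlow⟩ : ∃ U' ∈ 𝓝 (compactEmbed t y₀ hi q.toProb).1,
      ∀ p : WassersteinSpace Y t, (compactEmbed t y₀ hi p.toProb).1 ∈ U' →
        (moment t y₀ q.toProb).toReal - δ₁ < (moment t y₀ p.toProb).toReal := by
    rcases (ENNReal.toReal_nonneg (a := moment t y₀ q.toProb)).eq_or_lt with h0 | h0
    · exact ⟨univ, univ_mem, fun p _ => by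
        have := ENNReal.toReal_nonneg (a := moment t y₀ p.toProb)
        linarith⟩
    obtain ⟨h, hcont, hmono, hbd, -, hsup⟩ := exists_continuous_approx_edist t y₀ hi
    have hlt : ENNReal.ofReal ((moment t y₀ q.toProb).toReal - δ₁) < moment t y₀ q.toProb := by
      conv_rhs => rw [← ENNReal.ofReal_toReal (hfin q)]
      exact (ENNReal.ofReal_lt_ofReal_iff h0).2 (by linarith)
    conv_rhs at hlt => rw [moment_eq_iSup hi hcont hmono hsup]
    obtain ⟨n, hn⟩ := lt_iSup_iff.1 hlt
    have hc := ProbabilityMeasure.continuous_lintegral_of_ne_top (hcont n)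
      fun x => ((hbd n x).trans_lt (ENNReal.natCast_lt_top n)).ne
    refine ⟨{u | ENNReal.ofReal ((moment t y₀ q.toProb).toReal - δ₁) <
      ∫⁻ k, h n k ∂(u : Measure K)}, (isOpen_lt continuous_const hc).mem_nhds ?_, fun p hp => ?_⟩
    · change _ < ∫⁻ k, h n k ∂((compactEmbed t y₀ hi q.toProb).1 : Measure K)
      rwa [lintegral_compactEmbed y₀ hi q.toProb (hcont n).measurable]
    · have hp' : ENNReal.ofReal ((moment t y₀ q.toProb).toReal - δ₁) <
        ∫⁻ k, h n k ∂((compactEmbed t y₀ hi p.toProb).1 : Measure K) := hp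
      rw [lintegral_compactEmbed y₀ hi p.toProb (hcont n).measurable] at hp'
      have h1 : ENNReal.ofReal ((moment t y₀ q.toProb).toReal - δ₁) < moment t y₀ p.toProb := by
        rw [moment_eq_iSup hi hcont hmono hsup p.toProb]
        exact hp'.trans_le (le_iSup (fun n => ∫⁻ y, h n (i y) ∂(p.toProb : Measure Y)) n)
      by_contra! hle
      refine h1.not_ge ?_
      rw [← ENNReal.ofReal_toReal (hfin p)]
      exact ENNReal.ofReal_le_ofReal hle
  obtain ⟨s, δ₂, hδ₂, hs⟩ :=
    ProbabilityMeasure.exists_finset_integral_sub_lt_subset (inter_mem hU hU')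
  refine ⟨s, min δ₁ δ₂, lt_min hδ₁ hδ₂, fun p hp hM => hOC (x, p) ?_⟩
  have hpU := hs (compactEmbed t y₀ hi p.toProb).1 fun g hg => by
    rw [integral_compactEmbed, integral_compactEmbed]
    exact (hp g hg).trans_le (min_le_right _ _)
  refine hUW ⟨hpU.1, ?_⟩
  have := hδW (moment t y₀ p.toProb).toReal (abs_lt.2
    ⟨by linarith [hlow p hpU.2], hM.trans_le (min_le_left _ _)⟩)
  rwa [ENNReal.ofReal_toReal (hfin p)] at this

theorem nonneg_of_forall_le_mul_add_lt {b k u a₀ : ℝ} (h : ∀ a ≤ a₀, b * a + k < u) : 0 ≤ b := by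
  by_contra! hb
  have h1 := h (min a₀ ((u - k) / b)) (min_le_left _ _)
  have h2 := mul_le_mul_of_nonpos_left (min_le_right a₀ ((u - k) / b)) hb.le
  rw [mul_div_cancel₀ _ hb.ne] at h2
  linarith

/-- Only finitely many integrals and the moment matter near `q`, so Hahn–Banach in a
finite-dimensional space suffices. The box `S`, unbounded below in the moment and cost directions,
is separated from the convex set `T` of attainable values. -/
theorem exists_affine_minorant (ht : 1 ≤ t) (hC : ConditionAPlus C) (x : X)
    (q : WassersteinSpace Y t) {r : ℝ} (hr : (r : EReal) < C (x, q)) :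
    ∃ ψ ∈ PhiB Y t, ∀ p : WassersteinSpace Y t,
      ((r + ∫ y, ψ y ∂(q.toProb : Measure Y) : ℝ) : EReal) ≤
        C (x, p) + ((∫ y, ψ y ∂(p.toProb : Measure Y) : ℝ) : EReal) := by
  classical
  obtain ⟨y₀⟩ := q.toProb.nonempty
  obtain ⟨c, hc⟩ := hC.bddBelow
  obtain ⟨i, hi⟩ := Metric.PiNatEmbed.exists_embedding_to_hilbert_cube (X := Y)
  borelize (ℕ → unitInterval)
  obtain ⟨s, δ, hδ, hs⟩ := exists_finset_lt_cost ht y₀ hi hC.lsc hr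
  have hgi : ∀ (g : C(ℕ → unitInterval, ℝ)) (p : ProbabilityMeasure Y),
      Integrable (fun y => g (i y)) (p : Measure Y) := fun g p =>
    ((BoundedContinuousFunction.mkOfCompact g).compContinuous ⟨i, hi.continuous⟩).integrable _
  let M : WassersteinSpace Y t → ℝ := fun p => (moment t y₀ p.toProb).toReal
  let v : WassersteinSpace Y t → s → ℝ := fun p g =>
    (∫ y, g.1 (i y) ∂(p.toProb : Measure Y)) - ∫ y, g.1 (i y) ∂(q.toProb : Measure Y)
  let S : Set ((s → ℝ) × ℝ × ℝ) := Metric.ball 0 δ ×ˢ Iio δ ×ˢ Iio r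
  let T : Set ((s → ℝ) × ℝ × ℝ) :=
    {z | ∃ p, z.1 = v p ∧ M p - M q ≤ z.2.1 ∧ C (x, p) ≤ (z.2.2 : EReal)}
  have hT : Convex ℝ T := by
    rintro ⟨v₁, a₁, w₁⟩ ⟨p₁, hv₁, ha₁, hw₁⟩ ⟨v₂, a₂, w₂⟩ ⟨p₂, hv₂, ha₂, hw₂⟩ α β hα hβ hαβ
    simp only at hv₁ hv₂ ha₁ ha₂ hw₁ hw₂
    obtain ⟨p, hp⟩ := exists_mixture ht p₁ p₂ hα hβ hαβ
    obtain rfl : β = 1 - α := by linarith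
    refine ⟨p, ?_, ?_, ?_⟩
    · funext g
      simp only [Prod.fst_add, Prod.smul_fst, Pi.add_apply, Pi.smul_apply, smul_eq_mul, hv₁, hv₂, v]
      rw [integral_mixture hα hβ hp (hgi g _) (hgi g _)]
      ring
    · simp only [Prod.snd_add, Prod.smul_snd, Prod.fst_add, Prod.smul_fst, smul_eq_mul, M]
      rw [toReal_moment_mixture ht hα hβ hp y₀]
      nlinarith [mul_le_mul_of_nonneg_left ha₁ hα, mul_le_mul_of_nonneg_left ha₂ hβ]
    · simp only [Prod.snd_add, Prod.smul_snd, smul_eq_mul]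
      refine (hC.convex x p₁ p₂ p α hα (by linarith) hp).trans ?_
      rw [EReal.coe_add, EReal.coe_mul, EReal.coe_mul]
      exact add_le_add (mul_le_mul_of_nonneg_left hw₁ (EReal.coe_nonneg.2 hα))
        (mul_le_mul_of_nonneg_left hw₂ (EReal.coe_nonneg.2 hβ))
  have hST : Disjoint S T := by
    rw [Set.disjoint_left]
    rintro ⟨v', a, w⟩ ⟨hv', ha, hw⟩ ⟨p, hvp, hap, hwp⟩
    simp only at hv' ha hw hvp hap hwp
    subst hvp
    refine absurd (hs p (fun g hg => ?_) (hap.trans_lt ha))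
      (not_lt.2 (hwp.trans (EReal.coe_le_coe_iff.2 (le_of_lt hw))))
    exact (norm_le_pi_norm (v p) ⟨g, hg⟩).trans_lt (mem_ball_zero_iff.1 hv')
  obtain ⟨f, u₀, hfS, hfT⟩ := geometric_hahn_banach_open
    ((convex_ball _ _).prod ((convex_Iio _).prod (convex_Iio _)))
    (Metric.isOpen_ball.prod (isOpen_Iio.prod isOpen_Iio)) hT hST
  let β : ℝ := f (0, 1, 0)
  let γ : ℝ := f (0, 0, 1)
  let A : s → ℝ := fun g => f (Pi.single g 1, 0, 0)
  have hf : ∀ v' a w, f (v', a, w) = ∑ g, v' g * A g + β * a + γ * w := by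
    intro v' a w
    have h1 : ((v', a, w) : (s → ℝ) × ℝ × ℝ) =
        ∑ g, v' g • ((Pi.single g 1, 0, 0) : (s → ℝ) × ℝ × ℝ) + a • ((0, 1, 0) : (s → ℝ) × ℝ × ℝ) +
          w • ((0, 0, 1) : (s → ℝ) × ℝ × ℝ) := by
      refine Prod.ext ?_ (Prod.ext ?_ ?_)
      · funext g
        simp [Prod.fst_sum, Finset.sum_apply, Pi.single_apply]
      · simp [Prod.snd_sum]
      · simp [Prod.snd_sum]
    rw [h1]
    simp only [map_add, map_sum, map_smul, smul_eq_mul, A, β, γ]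
    ring
  have hS : ∀ a < δ, ∀ w < r, β * a + γ * w < u₀ := by
    intro a ha w hw
    have := hfS (0, a, w) ⟨Metric.mem_ball_self hδ, ha, hw⟩
    rw [hf] at this
    simpa using this
  -- The box contains rays towards `-∞` in both scalar directions, which forces nonnegative
  -- coefficients. For `β` this makes the potential bounded from below.
  have hβ : 0 ≤ β := nonneg_of_forall_le_mul_add_lt (a₀ := 0) (k := γ * (r - 1)) fun a ha =>
    hS a (ha.trans_lt hδ) _ (by linarith)
  have hγ : 0 ≤ γ := nonneg_of_forall_le_mul_add_lt (a₀ := r - 1) (k := 0) (u := u₀) fun w hw => by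
    have := hS 0 hδ w (by linarith)
    linarith
  have hfp : ∀ (p : WassersteinSpace Y t) (w : ℝ), C (x, p) = w →
      u₀ ≤ ∑ g, v p g * A g + β * (M p - M q) + γ * w := by
    intro p w hw
    rw [← hf]
    exact hfT _ ⟨p, rfl, le_rfl, hw.le⟩
  -- If `γ > 0`, dividing by `γ` gives the minorant. If `γ = 0` the hyperplane is vertical: the
  -- remaining functional is at least `u₀ > 0` wherever the cost is finite, and a large multiple of
  -- it closes the gap between the lower bound `c` and `r`.
  obtain ⟨N, hN, hNp⟩ : ∃ N : ℝ, 0 ≤ N ∧ ∀ (p : WassersteinSpace Y t) (w : ℝ), C (x, p) = w →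
      r ≤ w + N * (∑ g, v p g * A g + β * (M p - M q)) := by
    rcases hγ.eq_or_lt with h0 | h0
    · have hu₀ : 0 < u₀ := by
        have := hS 0 hδ (r - 1) (by linarith)
        rw [← h0] at this
        linarith
      refine ⟨|r - c| / u₀, by positivity, fun p w hw => ?_⟩
      have h1 := hfp p w hw
      rw [← h0, zero_mul, add_zero] at h1
      have h2 := mul_le_mul_of_nonneg_left h1 (by positivity : 0 ≤ |r - c| / u₀)
      rw [div_mul_cancel₀ _ hu₀.ne'] at h2
      have h3 : c ≤ w := EReal.coe_le_coe_iff.1 (hw ▸ hc (x, p))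
      linarith [le_abs_self (r - c)]
    · have hru : γ * r ≤ u₀ := by
        by_contra! hlt
        have := hS 0 hδ (u₀ / γ) (by rwa [div_lt_iff₀ h0, mul_comm])
        rw [mul_div_cancel₀ _ h0.ne'] at this
        linarith
      refine ⟨1 / γ, by positivity, fun p w hw => ?_⟩
      have h1 := hru.trans (hfp p w hw)
      have h2 := mul_le_mul_of_nonneg_left h1 (by positivity : 0 ≤ 1 / γ)
      have h3 : 1 / γ * (γ * r) = r := by field_simp
      have h4 : 1 / γ * (∑ g, v p g * A g + β * (M p - M q) + γ * w) =
        w + 1 / γ * (∑ g, v p g * A g + β * (M p - M q)) := by field_simp; ring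
      linarith
  let G : C(ℕ → unitInterval, ℝ) := ∑ g : s, (N * A g) • g.1
  have hGle : ∀ y, |G (i y)| ≤ ‖G‖ := fun y => G.norm_coe_le_norm (i y)
  refine ⟨fun y => G (i y) + N * β * dist y y₀ ^ t,
    add_dist_rpow_mem_PhiB ht (G.continuous.comp hi.continuous) hGle (mul_nonneg hN hβ) y₀,
    fun p => ?_⟩
  have hGint : ∀ p : ProbabilityMeasure Y, ∫ y, G (i y) ∂(p : Measure Y) =
      ∑ g : s, N * A g * ∫ y, g.1 (i y) ∂(p : Measure Y) := by
    intro p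
    simp only [G, ContinuousMap.coe_sum, ContinuousMap.coe_smul, Finset.sum_apply, Pi.smul_apply,
      smul_eq_mul]
    rw [integral_finsetSum _ fun g _ => (hgi g.1 p).const_mul _]
    simp only [integral_const_mul]
  rw [integral_add_dist_rpow ht p.finite_moment (hgi G _),
    integral_add_dist_rpow ht q.finite_moment (hgi G _), hGint, hGint]
  induction hw : C (x, p) with
  | bot => exact absurd (hw ▸ hc (x, p)) (by simp)
  | top =>
    rw [EReal.top_add_of_ne_bot (EReal.coe_ne_bot _)]
    exact le_top
  | coe w =>
    rw [← EReal.coe_add, EReal.coe_le_coe_iff]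
    have h1 := hNp p w hw
    have h2 : N * (∑ g, v p g * A g + β * (M p - M q)) =
        (∑ g : s, N * A g * ∫ y, g.1 (i y) ∂(p.toProb : Measure Y)) -
        (∑ g : s, N * A g * ∫ y, g.1 (i y) ∂(q.toProb : Measure Y)) +
        (N * β * M p - N * β * M q) := by
      rw [← Finset.sum_sub_distrib, mul_add, Finset.mul_sum]
      congr 1
      · exact Finset.sum_congr rfl fun g _ => by simp only [v]; ring
      · ring
    rw [h2] at h1
    linarith

end AffineMinorant

end WeakTransport

end

/-! ### Comparison of the lifted and the weak problem. -/

section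

open Filter Topology TopologicalSpace ProbabilityTheory
open MeasureTheory.ProbabilityMeasure (evalKernel)

namespace WeakTransport

variable {X Y : Type*} [TopologicalSpace X] [MetricSpace Y] [PolishSpace Y] [MeasurableSpace Y]
  [BorelSpace Y] {t : ℝ} {C : X × WassersteinSpace Y t → EReal}

/-- Jensen's inequality at the barycentre `q` of `Q`: an affine minorant nearly exact at `q` can be
integrated, and its linear part averages to its value at `q`. -/
theorem shiftCost_le_lintegral (ht : 1 ≤ t) (hC : ConditionAPlus C) {c : ℝ}
    (hc : ∀ z, (c : EReal) ≤ C z) (x : X) {Q : Measure (ProbabilityMeasure Y)}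
    [IsProbabilityMeasure Q] {q : ProbabilityMeasure Y} (hq : HasFiniteMoment t q)
    (hQ : Q.bind (evalKernel Y) = q) :
    shiftCost C c (x, q) ≤ ∫⁻ p, shiftCost C c (x, p) ∂Q := by
  refine le_of_forall_lt_imp_le_of_dense fun ρ hρ => ?_
  have hρtop : ρ ≠ ∞ := hρ.ne_top
  have hr : ((ρ.toReal + c : ℝ) : EReal) < C (x, ⟨q, hq⟩) := by
    rw [← extendCost_toProb C, EReal.coe_add, ← not_le]
    intro hle
    refine hρ.not_ge (toENNReal_sub_le_iff.2 (hle.trans (le_of_eq ?_)))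
    rw [← EReal.coe_toReal (x := (ρ : EReal)) (by simpa using hρtop) (by simp)]
    simp
  obtain ⟨ψ, hψ, hle⟩ := exists_affine_minorant ht hC x ⟨q, hq⟩ hr
  obtain ⟨l, hl⟩ := hψ.2.2
  have hpt : ∀ p : ProbabilityMeasure Y,
      ρ + ENNReal.ofReal ((∫ y, ψ y ∂(q : Measure Y)) - l) ≤
        shiftCost C c (x, p) + ENNReal.ofReal ((∫ y, ψ y ∂(p : Measure Y)) - l) := by
    intro p
    rcases eq_or_ne (shiftCost C c (x, p)) ∞ with htop | htop
    · simp [htop]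
    have hp : HasFiniteMoment t p := by
      by_contra hp
      exact htop (by simp [shiftCost, extendCost_of_not_hasFiniteMoment C x hp])
    have h1 := hle ⟨p, hp⟩
    rw [← extendCost_toProb C, ← coe_shiftCost_add hc, ← ENNReal.ofReal_toReal htop,
      EReal.coe_ennreal_ofReal, max_eq_left ENNReal.toReal_nonneg, ← EReal.coe_add,
      ← EReal.coe_add, EReal.coe_le_coe_iff] at h1
    rw [← ENNReal.ofReal_toReal htop, ← ENNReal.ofReal_toReal hρtop,
      ← ENNReal.ofReal_add ENNReal.toReal_nonneg
        (sub_nonneg.2 (le_integral_of_mem_PhiB ht hψ hl hq)),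
      ← ENNReal.ofReal_add ENNReal.toReal_nonneg
        (sub_nonneg.2 (le_integral_of_mem_PhiB ht hψ hl hp))]
    exact ENNReal.ofReal_le_ofReal (by linarith)
  have hint := lintegral_mono (μ := Q) hpt
  rw [lintegral_const, measure_univ, mul_one,
    lintegral_add_right _ (measurable_ofReal_integral_sub hψ l),
    lintegral_ofReal_integral_sub ht hq hQ hψ hl] at hint
  exact (ENNReal.add_le_add_iff_right ENNReal.ofReal_ne_top).1 hint

variable [PolishSpace X] [MeasurableSpace X] [BorelSpace X] [Nonempty Y]

/-- The law of `(x, π_x)` under `μ` is a lifted coupling of the same cost; convexity plays no role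
here. -/
theorem liftedValue_le_weakValue (ht : 1 ≤ t) (hC : ConditionA C) (μ : ProbabilityMeasure X)
    (ν : ProbabilityMeasure Y) : liftedValue C μ ν ≤ weakValue C μ ν := by
  refine le_iInf₂ fun π hπ => ?_
  let κ := (π : Measure (X × Y)).condKernel
  let φ : X → X × ProbabilityMeasure Y := fun x => (x, ⟨κ x, inferInstance⟩)
  have hφ₂ : Measurable fun x => (⟨κ x, inferInstance⟩ : ProbabilityMeasure Y) :=
    ProbabilityMeasure.measurable_of_measurable_toMeasure κ.measurable
  have hφ : Measurable φ := measurable_id.prodMk hφ₂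
  let P : ProbabilityMeasure (X × ProbabilityMeasure Y) := μ.map hφ.aemeasurable
  have hP₀ : (P : Measure (X × ProbabilityMeasure Y)) = (μ : Measure X).map φ := rfl
  have hP : P ∈ liftedCouplings μ ν := by
    rw [mem_liftedCouplings_iff, hP₀, Measure.map_map measurable_fst hφ,
      Measure.map_map measurable_snd hφ]
    refine ⟨Measure.map_id, ?_⟩
    have hfst : (π : Measure (X × Y)).fst = μ := hπ.1
    have hdis := (π : Measure (X × Y)).disintegrate κ
    have hsnd := congrArg Measure.snd hdis
    rw [Measure.snd_compProd, hfst] at hsnd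
    rw [← hπ.2, ← Measure.snd, ← hsnd]
    ext s hs
    rw [ProbabilityMeasure.bind_evalKernel_apply _ hs, Measure.bind_apply hs κ.aemeasurable]
    exact lintegral_map
      ((Measure.measurable_coe hs).comp ProbabilityMeasure.measurable_toMeasure) hφ₂
  refine (iInf₂_le P hP).trans (le_of_eq ?_)
  have hm := measurable_extendCost ht hC
  have hn : Measurable fun z => (-extendCost C z).toENNReal := hm.neg.ereal_toENNReal
  rw [eintegral, eintegral, hP₀, lintegral_map hm.ereal_toENNReal hφ, lintegral_map hn hφ]

/-- Disintegrate `P` over `μ` and replace each conditional law on `P(Y)` by its barycentre. This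
gives a coupling of `μ` and `ν`, and Jensen's inequality compares the costs fibre by fibre. -/
theorem weakValue_le_liftedValue (ht : 1 ≤ t) (hC : ConditionAPlus C) (μ : ProbabilityMeasure X)
    {ν : ProbabilityMeasure Y} (hν : HasFiniteMoment t ν) :
    weakValue C μ ν ≤ liftedValue C μ ν := by
  have := ProbabilityMeasure.standardBorelSpace (Y := Y)
  obtain ⟨c, hc⟩ := hC.bddBelow
  obtain ⟨y₀⟩ := ‹Nonempty Y›
  have hm := measurable_extendCost ht hC.toConditionA
  refine le_iInf₂ fun P hP => ?_
  obtain ⟨hP₁, hP₂⟩ := mem_liftedCouplings_iff.1 hP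
  have : Nonempty (ProbabilityMeasure Y) := ⟨ν⟩
  let κ := (P : Measure (X × ProbabilityMeasure Y)).condKernel
  have hfst : (P : Measure (X × ProbabilityMeasure Y)).fst = μ := hP₁
  have hdis : (μ : Measure X) ⊗ₘ κ = P := by
    rw [← hfst]
    exact (P : Measure (X × ProbabilityMeasure Y)).disintegrate κ
  let κ' : Kernel X Y := evalKernel Y ∘ₖ κ
  have hμκ' : (μ : Measure X).bind κ' = ν := by
    rw [← hP₂, ← Measure.snd, ← hdis, Measure.snd_compProd, Measure.comp_assoc]
  let π : ProbabilityMeasure (X × Y) := ⟨(μ : Measure X) ⊗ₘ κ', inferInstance⟩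
  have hπ₀ : (π : Measure (X × Y)) = (μ : Measure X) ⊗ₘ κ' := rfl
  have hπfst : (π : Measure (X × Y)).fst = μ := by rw [hπ₀, Measure.fst_compProd]
  have hπ : π ∈ couplings μ ν := by
    refine ⟨hπfst, ?_⟩
    rw [← Measure.snd, hπ₀, Measure.snd_compProd, hμκ']
  -- Disintegrations are unique only almost everywhere, which suffices to identify the barycentre
  -- kernel under the integral.
  have hcond : ∀ᵐ x ∂(μ : Measure X), κ' x = (π : Measure (X × Y)).condKernel x := by
    have := eq_condKernel_of_measure_eq_compProd (ρ := (π : Measure (X × Y))) κ' (by rw [hπfst, hπ₀])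
    rwa [hπfst] at this
  have hmom : ∀ᵐ x ∂(μ : Measure X), ∫⁻ y, edist y y₀ ^ t ∂(κ' x) < ∞ := by
    have hd : Measurable fun y : Y => edist y y₀ ^ t := by fun_prop
    refine ae_lt_top (hd.lintegral_kernel) ?_
    rw [← Measure.lintegral_bind κ'.aemeasurable (by fun_prop), hμκ']
    exact (moment_lt_top_of_hasFiniteMoment ht hν y₀).ne
  refine (iInf₂_le π hπ).trans ?_
  have hmπ : Measurable fun x => extendCost C
      (x, (⟨(π : Measure (X × Y)).condKernel x, inferInstance⟩ : ProbabilityMeasure Y)) :=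
    hm.comp (measurable_id.prodMk (ProbabilityMeasure.measurable_of_measurable_toMeasure
      (π : Measure (X × Y)).condKernel.measurable))
  rw [eintegral_eq_lintegral_add hmπ.aemeasurable fun x => le_extendCost hc _,
    eintegral_eq_lintegral_add hm.aemeasurable (le_extendCost hc)]
  refine add_le_add_left (EReal.coe_ennreal_le_coe_ennreal_iff.2 ?_) _
  change _ ≤ ∫⁻ z, shiftCost C c z ∂(P : Measure (X × ProbabilityMeasure Y))
  rw [← hdis, Measure.lintegral_compProd (measurable_shiftCost ht hC.lsc c)]
  refine lintegral_mono_ae ?_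
  filter_upwards [hcond, hmom] with x hx hxm
  refine shiftCost_le_lintegral ht hC hc x ⟨y₀, ?_⟩ ?_
  · change ∫⁻ y, edist y y₀ ^ t ∂((π : Measure (X × Y)).condKernel x) < ∞
    rwa [← hx]
  · change _ = (π : Measure (X × Y)).condKernel x
    rw [← hx, Kernel.comp_apply]

end WeakTransport

end

theorem theorem3p1 {X Y : Type*}
    [TopologicalSpace X] [PolishSpace X] [MeasurableSpace X] [BorelSpace X]
    [MetricSpace Y] [PolishSpace Y] [MeasurableSpace Y] [BorelSpace Y] [Nonempty Y]
    (t : ℝ) (ht : 1 ≤ t)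
    (C : X × WeakTransport.WassersteinSpace Y t → EReal) (hC : WeakTransport.ConditionA C)
    (μ : ProbabilityMeasure X) (ν : WeakTransport.WassersteinSpace Y t) :
    (∀ ψ ∈ WeakTransport.PhiB Y t, AEMeasurable (WeakTransport.conjugate C ψ) (μ : Measure X)) ∧
    WeakTransport.liftedValue C μ ν.toProb = WeakTransport.dualValue C μ ν.toProb ∧
    (WeakTransport.ConditionAPlus C →
      WeakTransport.weakValue C μ ν.toProb = WeakTransport.dualValue C μ ν.toProb) := by
  refine ⟨fun ψ hψ => WeakTransport.aemeasurable_conjugate ht hC hψ _,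
    WeakTransport.liftedValue_eq_dualValue ht hC μ ν, fun h => ?_⟩
  rw [← WeakTransport.liftedValue_eq_dualValue ht hC μ ν]
  exact le_antisymm (WeakTransport.weakValue_le_liftedValue ht h μ ν.finite_moment)
    (WeakTransport.liftedValue_le_weakValue ht hC μ ν.toProb)
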